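/- **Setting.** Let $k\ge 0$. A *$k$-partition diagram* is an equivalence relation on $\underline k\cup\underline k'$, where $\underline k=\{1,\dots,k\}$ is the top row and $\underline k'=\{1',\dots,k'\}$ the bottom row. A *diagram of the algebra of $\mathbb Z_2$-relations* is an equivalence relation on $(\underline k\cup\underline k')\times\mathbb Z_2$ that is stable under the action $g.(i,h)=(i,gh)$ of $\mathbb Z_2=\{e,g\}$; its top row is $\underline k\times\mathbb Z_2$ and its bottom row $\underline k'\times\mathbb Z_2$. Equivalence classes are called connected components. A component meeting both rows is a *through class*; a component inside one row is a *horizontal edge*. A component $C$ of a $\mathbb Z_2$-stable diagram is a *$\mathbb Z_2$-class* if $gC=C$ and an *$\{e\}$-class* if $gC\cap C=\emptyset$; $\{e\}$-classes occur in pairs $C,gC$. Only diagrams are considered in which the relation on the bottom row is the copy of the relation on the top row and every top-row vertex belonging to a through class is equivalent to its copy in the bottom row. For such diagrams the horizontal edges of the top row are counted (those of the bottom row are their copies). Let $J^{2k}_{2s_1+s_2}$ be the set of such $\mathbb Z_2$-stable diagrams with $s_1$ pairs of $\{e\}$-through classes and $s_2$ $\mathbb Z_2$-through classes, and $J^k_s$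 the set of such $k$-partition diagrams with $s$ through classes. "$2r_1+r_2$ horizontal edges" means $r_1$ pairs of $\{e\}$-horizontal edges and $r_2$ $\mathbb Z_2$-horizontal edges. For $d,d'\in J^{2k}_{2s_1+s_2}$, $d'$ is *coarser* than $d$ if: each $\{e\}$-through class of $d$ is contained in an $\{e\}$-through class of $d'$; each $\mathbb Z_2$-through class of $d$ is contained in a $\mathbb Z_2$-through class of $d'$; each $\{e\}$-horizontal edge of $d$ is contained in a horizontal edge or through class of $d'$ (of either type); each $\mathbb Z_2$-horizontal edge of $d$ is contained in a $\mathbb Z_2$-horizontal edge or $\mathbb Z_2$-through class of $d'$; and different through classes of $d$ lie in different through classes of $d'$. For $d,d'\in J^k_s$, $d'$ is coarser than $d$ if each through class of $d$ is contained in a through class of $d'$, different ones in different ones, and each horizontal edge of $d$ is contained in a horizontal edge or through class of $d'$. (So $d$ is coarser than itself.) $S(n,m)$ denotes the Stirling numbers of the second kind; $0^0=1$, and a sum over an empty range is $0$. **Lemma.** (a) Let $d\in J^{2k}_{2s_1+s_2}$ have $2r_1+r_2$ horizontal edges. For all $p_1,p_2\ge 0$ the number of diagrams in $J^{2k}_{2s_1+s_2}$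 that have $2p_1+p_2$ horizontal edges and are coarser than $d$ is $$\sum_{i=p_1}^{r_1}\binom{r_1}{i}2^{i-p_1}S(i,p_1)\left[\sum_{j=0}^{r_1-i}\binom{r_1-i}{j}(2s_1+s_2)^{r_1-i-j}\left[\sum_{l=\max(p_2-j,0)}^{r_2}\binom{r_2}{l}s_2^{\,r_2-l}S(l+j,p_2)\right]\right].$$ In particular: (i) if $r_1=0$, the number of diagrams in $J^{2k}_{2s_1+s_2}$ that have $p_2$ $\mathbb Z_2$-horizontal edges and are coarser than $d$ is $\sum_{i=p_2}^{r_2}\binom{r_2}{i}s_2^{\,r_2-i}S(i,p_2)$; (ii) if $s_1=s_2=0$, the number of diagrams in $J^{2k}_{0}$ that have $2p_1+p_2$ horizontal edges and are coarser than $d$ is $\sum_{i=p_1}^{r_1}\binom{r_1}{i}2^{i-p_1}S(i,p_1)\,S(r_2+r_1-i,p_2)$. (b) Let $d\in J^k_s$ have $r$ horizontal edges. For all $p\ge 0$ the number of diagrams in $J^k_s$ that have $p$ horizontal edges and are coarser than $d$ is $\sum_{i=p}^{r}\binom{r}{i}s^{r-i}S(i,p)$. -/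

import Mathlib

/-! ### Two-row diagrams

A diagram with two rows, each indexed by `X`, is an equivalence relation on `X ⊕ X`; `Sum.inl x` is
the vertex `x` of the top row, `Sum.inr x` is the vertex `x'` below it.  Its connected components
are its equivalence classes. -/

namespace TwoRow

/-- A through class: a connected component that meets both rows. -/
def IsThroughClass {X : Type} (d : Setoid (X ⊕ X)) (C : Set (X ⊕ X)) : Prop :=
  C ∈ d.classes ∧ (∃ x, Sum.inl x ∈ C) ∧ (∃ x, Sum.inr x ∈ C)

/-- A horizontal edge of the top row: a connected component inside the top row. -/
def IsTopEdge {X : Type} (d : Setoid (X ⊕ X)) (C : Set (X ⊕ X)) : Prop :=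
  C ∈ d.classes ∧ C ⊆ Set.range Sum.inl

/-- A horizontal edge of the bottom row: a connected component inside the bottom row. -/
def IsBottomEdge {X : Type} (d : Setoid (X ⊕ X)) (C : Set (X ⊕ X)) : Prop :=
  C ∈ d.classes ∧ C ⊆ Set.range Sum.inr

/-- A horizontal edge: a connected component inside one of the two rows. -/
def IsHorizontalEdge {X : Type} (d : Setoid (X ⊕ X)) (C : Set (X ⊕ X)) : Prop :=
  IsTopEdge d C ∨ IsBottomEdge d C

/-- The diagrams `U_{(d,P)}^{(d,P)}`: both rows carry the same equivalence relation, and every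
block of the top row that belongs to a through class is joined to its own copy in the bottom row
(the permutation of the through classes is the identity). -/
def IsDoubled {X : Type} (d : Setoid (X ⊕ X)) : Prop :=
  (∀ x y : X, d (Sum.inl x) (Sum.inl y) ↔ d (Sum.inr x) (Sum.inr y)) ∧
  (∀ x y : X, d (Sum.inl x) (Sum.inr y) → d (Sum.inl x) (Sum.inr x))

/-- No connected component of `d'` contains two different through classes of `d`. -/
def SeparatesThrough {X : Type} (d d' : Setoid (X ⊕ X)) : Prop :=
  ∀ C₁ C₂ C' : Set (X ⊕ X), IsThroughClass d C₁ → IsThroughClass d C₂ → C' ∈ d'.classes →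
    C₁ ⊆ C' → C₂ ⊆ C' → C₁ = C₂

end TwoRow

/-! ### Partition diagrams -/

namespace PartitionDiagram

open TwoRow

/-- The set `J^k_s`: doubled `k`-partition diagrams with `s` through classes. -/
def J (k s : ℕ) : Set (Setoid (Fin k ⊕ Fin k)) :=
  {d | IsDoubled d ∧ {C | IsThroughClass d C}.ncard = s}

/-- The number of horizontal edges in (each row of) a doubled diagram. -/
noncomputable def numEdges {k : ℕ} (d : Setoid (Fin k ⊕ Fin k)) : ℕ :=
  {C | IsTopEdge d C}.ncard

/-- `d'` is coarser than `d` (for diagrams with the same number of through classes). -/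
def IsCoarser {k : ℕ} (d d' : Setoid (Fin k ⊕ Fin k)) : Prop :=
  (∀ C, IsThroughClass d C → ∃ C', IsThroughClass d' C' ∧ C ⊆ C') ∧
  (∀ C, IsHorizontalEdge d C →
    ∃ C', (IsHorizontalEdge d' C' ∨ IsThroughClass d' C') ∧ C ⊆ C') ∧
  SeparatesThrough d d'

end PartitionDiagram

/-! ### Diagrams of the algebra of `ℤ₂`-relations -/

namespace Z2Diagram

open TwoRow

/-- The vertices `(i, g)` of one row, `i` in `{1, …, k}` and `g` in `ℤ₂`. -/
abbrev Row (k : ℕ) : Type := Fin k × ZMod 2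

/-- The action `g.(i, h) = (i, gh)` of `ℤ₂` (written additively) on the vertices of both rows. -/
def act {k : ℕ} (g : ZMod 2) : Row k ⊕ Row k → Row k ⊕ Row k :=
  Sum.map (fun p => (p.1, g + p.2)) (fun p => (p.1, g + p.2))

/-- `ℤ₂`-stable equivalence relations. -/
def IsStable {k : ℕ} (d : Setoid (Row k ⊕ Row k)) : Prop :=
  ∀ (g : ZMod 2) (p q : Row k ⊕ Row k), d p q → d (act g p) (act g q)

/-- A connected component is an `{e}`-class if it never contains both `(i, e)` and `(i, g)`. -/
def IsEClass {k : ℕ} (d : Setoid (Row k ⊕ Row k)) (C : Set (Row k ⊕ Row k)) : Prop :=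
  C ∈ d.classes ∧ ∀ p ∈ C, act 1 p ∉ C

/-- A connected component is a `ℤ₂`-class if with each vertex it contains both `(i, e)`
and `(i, g)`. -/
def IsZ2Class {k : ℕ} (d : Setoid (Row k ⊕ Row k)) (C : Set (Row k ⊕ Row k)) : Prop :=
  C ∈ d.classes ∧ ∀ p ∈ C, act 1 p ∈ C

/-- The set `J^{2k}_{2s₁+s₂}`: doubled `ℤ₂`-stable diagrams with `s₁` pairs of `{e}`-through classes
and `s₂` many `ℤ₂`-through classes. -/
def J (k s₁ s₂ : ℕ) : Set (Setoid (Row k ⊕ Row k)) :=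
  {d | IsStable d ∧ IsDoubled d ∧
    {C | IsThroughClass d C ∧ IsEClass d C}.ncard = 2 * s₁ ∧
    {C | IsThroughClass d C ∧ IsZ2Class d C}.ncard = s₂}

/-- The number of `{e}`-horizontal edges in (each row of) a doubled diagram. -/
noncomputable def numEEdges {k : ℕ} (d : Setoid (Row k ⊕ Row k)) : ℕ :=
  {C | IsTopEdge d C ∧ IsEClass d C}.ncard

/-- The number of `ℤ₂`-horizontal edges in (each row of) a doubled diagram. -/
noncomputable def numZ2Edges {k : ℕ} (d : Setoid (Row k ⊕ Row k)) : ℕ :=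
  {C | IsTopEdge d C ∧ IsZ2Class d C}.ncard

/-- `d'` is coarser than `d` (for diagrams with the same numbers of through classes). -/
def IsCoarser {k : ℕ} (d d' : Setoid (Row k ⊕ Row k)) : Prop :=
  (∀ C, IsThroughClass d C → IsEClass d C →
    ∃ C', IsThroughClass d' C' ∧ IsEClass d' C' ∧ C ⊆ C') ∧
  (∀ C, IsThroughClass d C → IsZ2Class d C →
    ∃ C', IsThroughClass d' C' ∧ IsZ2Class d' C' ∧ C ⊆ C') ∧
  (∀ C, IsHorizontalEdge d C → IsEClass d C →
    ∃ C', (IsHorizontalEdge d' C' ∨ IsThroughClass d' C') ∧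
      (IsEClass d' C' ∨ IsZ2Class d' C') ∧ C ⊆ C') ∧
  (∀ C, IsHorizontalEdge d C → IsZ2Class d C →
    ∃ C', (IsHorizontalEdge d' C' ∨ IsThroughClass d' C') ∧ IsZ2Class d' C' ∧ C ⊆ C') ∧
  SeparatesThrough d d'

end Z2Diagram

/-! Let `Q` be the set of components of the top row of `d`, `σ` the involution on `Q`, and `T ⊆ Q`
the components that belong to through classes. A diagram `d'` with the same numbers of through
classes is coarser than `d` exactly when its top row contains that of `d`, no two points of `T` are
merged, and its through classes are those containing one of `d`; the last point is a counting
argument, because equal numbers leave no room for a new through class (`IsCoarser.refines`,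
`Refines.isCoarser`). So coarser diagrams correspond to the `σ`-stable equivalence relations on `Q`
that separate `T` (`diagramOf`, `Refines.exists_diagramOf_eq`), and horizontal edges correspond to
the classes off `T`, free or fixed under `σ`.

These relations are counted by removing one orbit outside `T` at a time. Suppose the rest has `a`
free and `b` fixed classes off `T`, and let `t` be the size of `T` and `s` the number of its fixed
points. A free orbit `{x, σ x}` forms two new free classes, or one new fixed class, or `x` joins one
of the `a + b + t` old classes and `σ x` its image. A fixed point forms a new fixed class or joins
one of the `b + s` fixed classes. On weights `w a b` these steps act as `freeOp + fixedOp + t` and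
`fixedOp + s` (`weightSum_of_invol_ne`, `weightSum_of_invol_eq`). The number sought is thus a
product of such operators applied to the indicator of `(2 * p₁, p₂)` and evaluated at the origin
(`weightSum_eq`).

Since `freeOp` and `fixedOp` commute, the binomial theorem expands this product into the triple sum,
with Stirling numbers as the values of `freeOp ^ i * fixedOp ^ n`
(`freeOp_pow_mul_fixedOp_pow_indicator`). Partition diagrams are the case `σ = id`, where every
class is fixed. -/

/-! ### Counting operators -/

namespace Z2Setoid

/-- The operator `w ↦ w (a + 2, b) + a w (a, b)` on weights. -/
def freeOp : Module.End ℕ (ℕ → ℕ → ℕ) where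
  toFun w a b := w (a + 2) b + a * w a b
  map_add' v w := by ext a b; simp only [Pi.add_apply]; ring
  map_smul' c w := by
    ext a b; simp only [Pi.smul_apply, smul_eq_mul, RingHom.id_apply]; ring

/-- The operator `w ↦ w (a, b + 1) + b w (a, b)` on weights. -/
def fixedOp : Module.End ℕ (ℕ → ℕ → ℕ) where
  toFun w a b := w a (b + 1) + b * w a b
  map_add' v w := by ext a b; simp only [Pi.add_apply]; ring
  map_smul' c w := by
    ext a b; simp only [Pi.smul_apply, smul_eq_mul, RingHom.id_apply]; ring

/-- The indicator weight of `(2 * p₁, p₂)`. -/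
def indicator (p₁ p₂ : ℕ) : ℕ → ℕ → ℕ := fun a b => if a = 2 * p₁ ∧ b = p₂ then 1 else 0

lemma freeOp_apply (w : ℕ → ℕ → ℕ) (a b : ℕ) : freeOp w a b = w (a + 2) b + a * w a b := rfl

lemma fixedOp_apply (w : ℕ → ℕ → ℕ) (a b : ℕ) : fixedOp w a b = w a (b + 1) + b * w a b := rfl

/-- The two operators act on different arguments of the weight. This is what makes the binomial
theorem available. -/
lemma commute_freeOp_fixedOp : Commute freeOp fixedOp := by
  apply LinearMap.ext
  intro w
  ext a b
  simp only [Module.End.mul_apply, freeOp_apply, fixedOp_apply]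
  ring

lemma fixedOp_indicator_zero (p₁ : ℕ) : fixedOp (indicator p₁ 0) = 0 := by
  ext a b
  simp [fixedOp_apply, indicator]

/-- The Stirling recursion in dual form: the last point is a class of its own or joins one of `p₂ +
1` classes. -/
lemma fixedOp_indicator_succ (p₁ p₂ : ℕ) : fixedOp (indicator p₁ (p₂ + 1)) =
    indicator p₁ p₂ + (p₂ + 1) • indicator p₁ (p₂ + 1) := by
  ext a b
  simp only [fixedOp_apply, indicator, Pi.add_apply, Pi.smul_apply, smul_eq_mul,
    Nat.add_right_cancel_iff]
  by_cases h : a = 2 * p₁ ∧ b = p₂ + 1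
  · rw [if_pos h, h.2]
  · simp [h]

lemma freeOp_indicator_zero (p₂ : ℕ) : freeOp (indicator 0 p₂) = 0 := by
  ext a b
  simp [freeOp_apply, indicator]
  omega

lemma freeOp_indicator_succ (p₁ p₂ : ℕ) : freeOp (indicator (p₁ + 1) p₂) =
    indicator p₁ p₂ + (2 * (p₁ + 1)) • indicator (p₁ + 1) p₂ := by
  ext a b
  simp only [freeOp_apply, indicator, Pi.add_apply, Pi.smul_apply, smul_eq_mul, mul_add,
    mul_one, Nat.add_right_cancel_iff]
  by_cases h : a = 2 * p₁ + 2 ∧ b = p₂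
  · rw [if_pos h, h.1]
  · simp [h]

/-- The factor `Nat.stirlingSecond 0 p₁` is the indicator of `p₁ = 0`, written so that it starts the
induction on the power of `freeOp`. -/
lemma fixedOp_pow_indicator (n p₁ p₂ : ℕ) : (fixedOp ^ n) (indicator p₁ p₂) 0 0 =
    Nat.stirlingSecond 0 p₁ * Nat.stirlingSecond n p₂ := by
  induction n generalizing p₂ with
  | zero =>
    cases p₁ <;> cases p₂ <;> simp [indicator]
  | succ n ih =>
    rw [pow_succ, Module.End.mul_apply]
    cases p₂ with
    | zero => simp [fixedOp_indicator_zero]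
    | succ p =>
      rw [fixedOp_indicator_succ, map_add, map_nsmul, Pi.add_apply, Pi.add_apply, Pi.smul_apply,
        Pi.smul_apply, ih, ih, Nat.stirlingSecond_succ_succ, smul_eq_mul]
      ring

/-- The recursion for free orbits: the last one starts a new pair of classes or joins one of `2 * (p
+ 1)` free classes. -/
lemma two_pow_mul_stirlingSecond_succ (i p : ℕ) :
    2 ^ (i + 1 - (p + 1)) * Nat.stirlingSecond (i + 1) (p + 1) =
      2 ^ (i - p) * Nat.stirlingSecond i p +
        2 * (p + 1) * (2 ^ (i - (p + 1)) * Nat.stirlingSecond i (p + 1)) := by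
  rw [Nat.stirlingSecond_succ_succ, Nat.add_sub_add_right]
  rcases Nat.lt_or_ge p i with h | h
  · obtain ⟨m, rfl⟩ := Nat.exists_eq_add_of_lt h
    rw [show p + m + 1 - p = m + 1 by omega, show p + m + 1 - (p + 1) = m by omega]
    ring
  -- Here the exponent `i - (p + 1)` is truncated, but its Stirling factor vanishes.
  · rw [Nat.stirlingSecond_eq_zero_of_lt (show i < p + 1 by omega)]
    ring

lemma freeOp_pow_mul_fixedOp_pow_indicator (i n p₁ p₂ : ℕ) :
    (freeOp ^ i * fixedOp ^ n) (indicator p₁ p₂) 0 0 =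
      2 ^ (i - p₁) * Nat.stirlingSecond i p₁ * Nat.stirlingSecond n p₂ := by
  induction i generalizing p₁ with
  | zero => simp [fixedOp_pow_indicator]
  | succ i ih =>
    -- Commutativity lets one `freeOp` act on the indicator first.
    have h : freeOp ^ (i + 1) * fixedOp ^ n = freeOp ^ i * fixedOp ^ n * freeOp := by
      rw [pow_succ, mul_assoc, mul_assoc, (commute_freeOp_fixedOp.pow_right n).eq]
    rw [h, Module.End.mul_apply]
    cases p₁ with
    | zero => simp [freeOp_indicator_zero]
    | succ p =>
      rw [freeOp_indicator_succ, map_add, map_nsmul, Pi.add_apply, Pi.add_apply, Pi.smul_apply,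
        Pi.smul_apply, ih, ih, two_pow_mul_stirlingSecond_succ, smul_eq_mul]
      ring

/-- The number of setoids to be counted, by numbers of free and fixed points. -/
def count (t s r₁ r₂ p₁ p₂ : ℕ) : ℕ :=
  ((fixedOp + (s : Module.End ℕ (ℕ → ℕ → ℕ))) ^ r₂ *
    (freeOp + (fixedOp + (t : Module.End ℕ (ℕ → ℕ → ℕ)))) ^ r₁) (indicator p₁ p₂) 0 0

lemma natCast_apply (m : ℕ) (w : ℕ → ℕ → ℕ) (a b : ℕ) :
    (m : Module.End ℕ (ℕ → ℕ → ℕ)) w a b = m * w a b := by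
  rw [Module.End.natCast_apply, Pi.smul_apply, Pi.smul_apply, smul_eq_mul]

lemma count_eq_range (t s r₁ r₂ p₁ p₂ : ℕ) : count t s r₁ r₂ p₁ p₂ =
    ∑ i ∈ Finset.range (r₁ + 1), ∑ j ∈ Finset.range (r₁ - i + 1), ∑ l ∈ Finset.range (r₂ + 1),
      r₁.choose i * ((r₁ - i).choose j * (r₂.choose l * (t ^ (r₁ - i - j) * (s ^ (r₂ - l) *
        (2 ^ (i - p₁) * Nat.stirlingSecond i p₁ * Nat.stirlingSecond (l + j) p₂))))) := by
  have key : (fixedOp + (s : Module.End ℕ (ℕ → ℕ → ℕ))) ^ r₂ *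
      (freeOp + (fixedOp + (t : Module.End ℕ (ℕ → ℕ → ℕ)))) ^ r₁ =
      ∑ i ∈ Finset.range (r₁ + 1), ∑ j ∈ Finset.range (r₁ - i + 1),
        ∑ l ∈ Finset.range (r₂ + 1),
          ((r₁.choose i * ((r₁ - i).choose j * (r₂.choose l * (t ^ (r₁ - i - j) *
            s ^ (r₂ - l)))) : ℕ) : Module.End ℕ (ℕ → ℕ → ℕ)) *
              (freeOp ^ i * fixedOp ^ (l + j)) := by
    have h1 : Commute freeOp (fixedOp + (t : Module.End ℕ (ℕ → ℕ → ℕ))) :=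
      commute_freeOp_fixedOp.add_right (Nat.cast_commute t _).symm
    have h2 : Commute (freeOp + (fixedOp + (t : Module.End ℕ (ℕ → ℕ → ℕ))))
        (fixedOp + (s : Module.End ℕ (ℕ → ℕ → ℕ))) := by
      refine Commute.add_right (Commute.add_left commute_freeOp_fixedOp
        (Commute.add_left (Commute.refl _) (Nat.cast_commute t _))) (Nat.cast_commute s _).symm
    rw [← (h2.pow_pow r₁ r₂).eq, h1.add_pow, Finset.sum_mul]
    refine Finset.sum_congr rfl fun i _ => ?_
    rw [(Nat.cast_commute t fixedOp).symm.add_pow, (Nat.cast_commute s fixedOp).symm.add_pow,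
      Finset.mul_sum _ _ (freeOp ^ i), Finset.sum_mul, Finset.sum_mul]
    refine Finset.sum_congr rfl fun j _ => ?_
    rw [Finset.mul_sum]
    refine Finset.sum_congr rfl fun l _ => ?_
    rw [show l + j = j + l by omega, pow_add]
    simp only [← Nat.cast_pow, ← nsmul_eq_mul', ← nsmul_eq_mul, smul_mul_assoc, mul_smul_comm,
      smul_smul, mul_assoc]
    congr 1
    ring
  rw [count, key]
  simp only [LinearMap.sum_apply, Finset.sum_apply, Module.End.mul_apply, natCast_apply]
  refine Finset.sum_congr rfl fun i _ => Finset.sum_congr rfl fun j _ =>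
    Finset.sum_congr rfl fun l _ => ?_
  rw [← Module.End.mul_apply, freeOp_pow_mul_fixedOp_pow_indicator]
  ring

/-- The terms dropped from the full ranges have `i < p₁` or `l + j < p₂`, so a Stirling factor is
zero. Truncated subtraction in `p₂ - j` supplies the maximum with `0`. -/
lemma count_eq (t s r₁ r₂ p₁ p₂ : ℕ) : count t s r₁ r₂ p₁ p₂ =
    ∑ i ∈ Finset.Icc p₁ r₁, r₁.choose i * 2 ^ (i - p₁) * Nat.stirlingSecond i p₁ *
      ∑ j ∈ Finset.Icc 0 (r₁ - i), (r₁ - i).choose j * t ^ (r₁ - i - j) *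
        ∑ l ∈ Finset.Icc (p₂ - j) r₂,
          r₂.choose l * s ^ (r₂ - l) * Nat.stirlingSecond (l + j) p₂ := by
  rw [count_eq_range]
  symm
  apply Finset.sum_subset_zero_on_sdiff
  · intro i hi
    simp only [Finset.mem_Icc, Finset.mem_range] at hi ⊢
    omega
  · intro i hi
    simp only [Finset.mem_Icc, Finset.mem_range, Finset.mem_sdiff] at hi
    simp [Nat.stirlingSecond_eq_zero_of_lt (show i < p₁ by omega)]
  intro i _
  rw [Finset.mul_sum, show Finset.Icc 0 (r₁ - i) = Finset.range (r₁ - i + 1) by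
    ext; simp]
  refine Finset.sum_congr rfl fun j _ => ?_
  rw [Finset.mul_sum, Finset.mul_sum]
  apply Finset.sum_subset_zero_on_sdiff
  · intro l hl
    simp only [Finset.mem_Icc, Finset.mem_range] at hl ⊢
    omega
  · intro l hl
    simp only [Finset.mem_Icc, Finset.mem_range, Finset.mem_sdiff] at hl
    simp [Nat.stirlingSecond_eq_zero_of_lt (show l + j < p₂ by omega)]
  intro l _
  ring

end Z2Setoid

/-! ### Stable equivalence relations on a set with involution -/

namespace Z2Setoid

section Defs

variable {Q : Type} (σ : Q → Q) (T : Set Q) (e : Setoid Q)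

/-- Equivalence relations that are stable under `σ` and separate the points of `T`. -/
structure IsAdmissible : Prop where
  stable : ∀ {x y}, e x y → e (σ x) (σ y)
  separates : ∀ {s t}, s ∈ T → t ∈ T → e s t → s = t

/-- The number of classes that are disjoint from `T` and are not preserved by `σ`. -/
noncomputable def numFree : ℕ :=
  ((Quotient.mk e) '' {x | ¬ e x (σ x) ∧ ∀ t ∈ T, ¬ e x t}).ncard

/-- The number of classes that are disjoint from `T` and are preserved by `σ`. -/
noncomputable def numFixed : ℕ :=
  ((Quotient.mk e) '' {x | e x (σ x) ∧ ∀ t ∈ T, ¬ e x t}).ncard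

end Defs

/-- Both images are the quotient of `P` by the same relation; no finiteness is needed. -/
lemma ncard_image_eq_of_forall_eq_iff {X A B : Type*} {P : Set X} {f : X → A} {g : X → B}
    (h : ∀ x ∈ P, ∀ y ∈ P, f x = f y ↔ g x = g y) : (f '' P).ncard = (g '' P).ncard := by
  have hc : ∀ a ∈ f '' P, ∃ x ∈ P, f x = a := fun a ha => ha
  choose c hc hfc using hc
  refine Set.ncard_congr (fun a ha => g (c a ha)) (fun a ha => ⟨_, hc a ha, rfl⟩) ?_ ?_
  · intro a b ha hb hab
    rw [← hfc a ha, ← hfc b hb]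
    exact (h _ (hc a ha) _ (hc b hb)).2 hab
  · rintro _ ⟨x, hx, rfl⟩
    refine ⟨f x, ⟨x, hx, rfl⟩, ?_⟩
    exact (h _ (hc _ _) _ hx).1 (hfc _ _)

lemma mk_eq_mk {Q : Type*} (e : Setoid Q) (x y : Q) :
    Quotient.mk e x = Quotient.mk e y ↔ e x y := Quotient.eq

section Kernel

variable {Q Y : Type} {σ : Q → Q} {T : Set Q} {τ : Y → Y} {f : Q → Y}

lemma numFree_ker (hf : ∀ q, f (σ q) = τ (f q)) : numFree σ T (Setoid.ker f) =
    {z | z ∈ Set.range f ∧ τ z ≠ z ∧ z ∉ f '' T}.ncard := by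
  rw [numFree, ncard_image_eq_of_forall_eq_iff (g := f) (by simp [mk_eq_mk, Setoid.ker_def])]
  congr 1
  ext z
  constructor
  · rintro ⟨x, ⟨h1, h2⟩, rfl⟩
    refine ⟨⟨x, rfl⟩, ?_, ?_⟩
    · rw [← hf]; exact fun h => h1 h.symm
    · rintro ⟨t, ht, h⟩; exact h2 t ht h.symm
  · rintro ⟨⟨x, rfl⟩, h1, h2⟩
    refine ⟨x, ⟨fun h => h1 ?_, fun t ht h => h2 ⟨t, ht, Eq.symm h⟩⟩, rfl⟩
    rw [← hf]; exact Eq.symm h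

lemma numFixed_ker (hf : ∀ q, f (σ q) = τ (f q)) : numFixed σ T (Setoid.ker f) =
    {z | z ∈ Set.range f ∧ τ z = z ∧ z ∉ f '' T}.ncard := by
  rw [numFixed, ncard_image_eq_of_forall_eq_iff (g := f) (by simp [mk_eq_mk, Setoid.ker_def])]
  congr 1
  ext z
  constructor
  · rintro ⟨x, ⟨h1, h2⟩, rfl⟩
    refine ⟨⟨x, rfl⟩, ?_, ?_⟩
    · rw [← hf]; exact Eq.symm h1
    · rintro ⟨t, ht, h⟩; exact h2 t ht h.symm
  · rintro ⟨⟨x, rfl⟩, h1, h2⟩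
    refine ⟨x, ⟨?_, fun t ht h => h2 ⟨t, ht, Eq.symm h⟩⟩, rfl⟩
    rw [← hf] at h1; exact Eq.symm h1

end Kernel

/-! ### Removing an orbit and extending maps over it -/

/-- The complement of an orbit. -/
abbrev Rest {Q : Type} (σ : Q → Q) (x : Q) : Type := {q : Q // q ≠ x ∧ q ≠ σ x}

/-- The involution on the complement of an orbit. -/
def restInvol {Q : Type} {σ : Q → Q} (hσ : Function.Involutive σ) (x : Q) :
    Rest σ x → Rest σ x :=
  fun q => ⟨σ q, fun h => q.2.2 ((hσ (q : Q)).symm.trans (congrArg σ h)),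
    fun h => q.2.1 (hσ.injective h)⟩

lemma restInvol_involutive {Q : Type} {σ : Q → Q} (hσ : Function.Involutive σ) (x : Q) :
    Function.Involutive (restInvol hσ x) := fun q => Subtype.ext (hσ q)

open Classical in
/-- The extension of `g` that sends `x` to `y` and is equivariant when possible. -/
noncomputable def extend {Q Y : Type} (σ : Q → Q) (τ : Y → Y) (x : Q) (g : Rest σ x → Y) (y : Y) :
    Q → Y :=
  fun q => if h : q ≠ x ∧ q ≠ σ x then g ⟨q, h⟩ else if q = x then y else τ y

section Extend

variable {Q Y : Type} {σ : Q → Q} {τ : Y → Y} {x : Q} {g : Rest σ x → Y} {y : Y}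

lemma extend_rest (q : Rest σ x) : extend σ τ x g y q = g q := by
  rw [extend, dif_pos q.2]

lemma extend_self : extend σ τ x g y x = y := by
  simp [extend]

lemma extend_invol (hy : σ x = x → τ y = y) : extend σ τ x g y (σ x) = τ y := by
  by_cases h : σ x = x
  · rw [hy h, h, extend_self]
  · simp [extend, h]

@[elab_as_elim]
lemma rest_cases {p : Q → Prop} (h1 : ∀ q : Rest σ x, p q) (h2 : p x) (h3 : p (σ x)) (q : Q) :
    p q := by
  by_cases h : q ≠ x ∧ q ≠ σ x
  · exact h1 ⟨q, h⟩
  · by_cases h' : q = x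
    · exact h' ▸ h2
    · have : q = σ x := by tauto
      exact this ▸ h3

lemma extend_equivariant (hσ : Function.Involutive σ) (hτ : Function.Involutive τ)
    (hg : ∀ q, g (restInvol hσ x q) = τ (g q)) (hy : σ x = x → τ y = y)
    (q : Q) :
    extend σ τ x g y (σ q) = τ (extend σ τ x g y q) := by
  refine rest_cases (σ := σ) (x := x) (fun q => ?_) ?_ ?_ q
  · rw [extend_rest, ← hg]
    exact extend_rest (restInvol hσ x q)
  · rw [extend_invol hy, extend_self]
  · rw [hσ, extend_invol hy, extend_self, hτ]

lemma range_extend (hy : σ x = x → τ y = y) :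
    Set.range (extend σ τ x g y) = Set.range g ∪ {y, τ y} := by
  ext z
  constructor
  · rintro ⟨q, rfl⟩
    refine rest_cases (σ := σ) (x := x) (fun q => ?_) ?_ ?_ q
    · rw [extend_rest]; exact Or.inl ⟨q, rfl⟩
    · rw [extend_self]; simp
    · rw [extend_invol hy]; simp
  · rintro (⟨q, rfl⟩ | rfl | rfl)
    · exact ⟨q, extend_rest q⟩
    · exact ⟨x, extend_self⟩
    · exact ⟨σ x, extend_invol hy⟩

lemma comap_ker_extend :
    Setoid.comap Subtype.val (Setoid.ker (extend σ τ x g y)) = Setoid.ker g := by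
  ext a b
  simp [Setoid.ker_def, extend_rest]

/-- A stable relation is determined by its restriction to the complement of the orbit, the class of
`x` there, and whether `x` and `σ x` are related; stability forces the rest. -/
lemma ker_extend (hσ : Function.Involutive σ) (hτ : Function.Involutive τ)
    (hg : ∀ q, g (restInvol hσ x q) = τ (g q)) (hy : σ x = x → τ y = y)
    {e : Setoid Q} (he : ∀ {x y}, e x y → e (σ x) (σ y))
    (h1 : ∀ p q : Rest σ x, g p = g q ↔ e p q) (h2 : ∀ q : Rest σ x, g q = y ↔ e q x)
    (h3 : τ y = y ↔ e (σ x) x) : Setoid.ker (extend σ τ x g y) = e := by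
  have h2' (q : Rest σ x) : g q = τ y ↔ e q (σ x) := by
    rw [← hτ.injective.eq_iff, hτ, ← hg, h2]
    constructor
    · intro h; simpa [restInvol, hσ _] using he h
    · intro h; simpa [restInvol, hσ _] using he h
  ext u v
  rw [Setoid.ker_def]
  refine rest_cases (σ := σ) (x := x) (fun p => ?_) ?_ ?_ u <;>
  refine rest_cases (σ := σ) (x := x) (fun q => ?_) ?_ ?_ v <;>
  simp only [extend_rest, extend_self, extend_invol hy]
  · exact h1 p q
  · exact h2 p
  · exact h2' p
  · exact eq_comm.trans ((h2 q).trans e.comm')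
  · exact iff_of_true trivial (e.refl' _)
  · exact eq_comm.trans (h3.trans e.comm')
  · exact eq_comm.trans ((h2' q).trans e.comm')
  · exact h3
  · exact iff_of_true trivial (e.refl' _)

end Extend

end Z2Setoid

/-! ### The induced involution on the classes -/

namespace Z2Setoid

section ClassInvol

variable {Q : Type} {σ : Q → Q} {T : Set Q} {e : Setoid Q}

/-- The map induced on the classes of an admissible equivalence relation. -/
def classInvol (he : IsAdmissible σ T e) : Quotient e → Quotient e :=
  Quotient.map σ fun _ _ h => he.stable h

lemma classInvol_mk (he : IsAdmissible σ T e) (q : Q) :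
    classInvol he (Quotient.mk e q) = Quotient.mk e (σ q) := rfl

lemma classInvol_involutive (hσ : Function.Involutive σ) (he : IsAdmissible σ T e) :
    Function.Involutive (classInvol he) := by
  intro c
  induction c using Quotient.inductionOn with
  | h q => rw [classInvol_mk, classInvol_mk, hσ]

lemma numFree_eq (he : IsAdmissible σ T e) : numFree σ T e =
    {c | classInvol he c ≠ c ∧ c ∉ Quotient.mk e '' T}.ncard := by
  have h := numFree_ker (σ := σ) (T := T) (τ := classInvol he) (f := Quotient.mk e)
    (classInvol_mk he)
  have hk : Setoid.ker (Quotient.mk e) = e := Setoid.ker_mk_eq e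
  rw [hk] at h
  rw [h]
  congr 1
  ext c
  simp

lemma numFixed_eq (he : IsAdmissible σ T e) : numFixed σ T e =
    {c | classInvol he c = c ∧ c ∉ Quotient.mk e '' T}.ncard := by
  have h := numFixed_ker (σ := σ) (T := T) (τ := classInvol he) (f := Quotient.mk e)
    (classInvol_mk he)
  have hk : Setoid.ker (Quotient.mk e) = e := Setoid.ker_mk_eq e
  rw [hk] at h
  rw [h]
  congr 1
  ext c
  simp

lemma injOn_mk (he : IsAdmissible σ T e) : Set.InjOn (Quotient.mk e) T :=
  fun _ hs _ ht h => he.separates hs ht ((mk_eq_mk e _ _).1 h)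

/-- If the class of `t ∈ T` is fixed, it contains both `t` and `σ t`, and separation gives `σ t =
t`. -/
lemma ncard_fixed_classes [Finite Q] (hT : ∀ t ∈ T, σ t ∈ T) (he : IsAdmissible σ T e) :
    {c | classInvol he c = c}.ncard = numFixed σ T e + {t | t ∈ T ∧ σ t = t}.ncard := by
  rw [numFixed_eq he, ← Set.InjOn.ncard_image ((injOn_mk he).mono (fun t ht => ht.1)),
    ← Set.ncard_union_eq _ (Set.toFinite _) (Set.toFinite _)]
  · congr 1
    ext c
    constructor
    · intro hc
      by_cases h : c ∈ Quotient.mk e '' T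
      · obtain ⟨t, ht, rfl⟩ := h
        exact Or.inr ⟨t, ⟨ht, injOn_mk he (hT t ht) ht hc⟩, rfl⟩
      · exact Or.inl ⟨hc, h⟩
    · rintro (h | ⟨t, ht, rfl⟩)
      · exact h.1
      · rw [Set.mem_ofPred_eq, classInvol_mk, ht.2]
  · rw [Set.disjoint_left]
    rintro c hc ⟨t, ht, rfl⟩
    exact hc.2 ⟨t, ht.1, rfl⟩

lemma card_quotient [Finite Q] (he : IsAdmissible σ T e) :
    Nat.card (Quotient e) = numFree σ T e + numFixed σ T e + T.ncard := by
  rw [numFree_eq he, numFixed_eq he, ← (injOn_mk he).ncard_image, ← Set.ncard_univ,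
    ← Set.ncard_union_eq _ (Set.toFinite _) (Set.toFinite _),
    ← Set.ncard_union_eq _ (Set.toFinite _) (Set.toFinite _)]
  · congr 1
    ext c
    simp only [Set.mem_univ, Set.mem_union, Set.mem_ofPred_eq, true_iff]
    tauto
  · rw [Set.disjoint_left]
    rintro c (hc | hc) h
    · exact hc.2 h
    · exact hc.2 h
  · rw [Set.disjoint_left]
    rintro c h1 h2
    exact h1.1 h2.1

end ClassInvol

/-! ### Adjoining an orbit to an admissible relation -/

section Adjoin

variable {Q : Type} {σ : Q → Q} (hσ : Function.Involutive σ) {T : Set Q} {x : Q}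
  {e₀ : Setoid (Rest σ x)}
  (h₀ : IsAdmissible (restInvol hσ x) (Subtype.val ⁻¹' T) e₀)

/-- The involution on the classes of `e₀` and up to three new classes. -/
def pointInvol : Quotient e₀ ⊕ Option Bool → Quotient e₀ ⊕ Option Bool :=
  Sum.map (classInvol h₀) (Option.map not)

lemma pointInvol_involutive : Function.Involutive (pointInvol hσ h₀) := by
  rintro (c | _ | b)
  · simp [pointInvol, classInvol_involutive (restInvol_involutive hσ x) h₀ c]
  · rfl
  · simp [pointInvol]

/-- The extension of `e₀` where `x` joins the class `y`. -/
noncomputable def adjoin (y : Quotient e₀ ⊕ Option Bool) : Setoid Q :=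
  Setoid.ker (extend σ (pointInvol hσ h₀) x (fun q => Sum.inl (Quotient.mk e₀ q)) y)

variable {hσ h₀} {y : Quotient e₀ ⊕ Option Bool}

lemma adjoin_equivariant (hy : σ x = x → pointInvol hσ h₀ y = y) (q : Q) :
    extend σ (pointInvol hσ h₀) x (fun q => Sum.inl (Quotient.mk e₀ q)) y (σ q) =
    pointInvol hσ h₀
      (extend σ (pointInvol hσ h₀) x (fun q => Sum.inl (Quotient.mk e₀ q)) y q) :=
  extend_equivariant hσ (pointInvol_involutive hσ h₀) (fun _ => rfl) hy q

lemma ne_of_mem (hT : ∀ t ∈ T, σ t ∈ T) (hσ : Function.Involutive σ) (hx : x ∉ T) {t : Q}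
    (ht : t ∈ T) : t ≠ x ∧ t ≠ σ x :=
  ⟨fun h => hx (h ▸ ht), fun h => hx (hσ x ▸ hT _ (h ▸ ht))⟩

lemma isAdmissible_adjoin (hT : ∀ t ∈ T, σ t ∈ T) (hx : x ∉ T)
    (hy : σ x = x → pointInvol hσ h₀ y = y) : IsAdmissible σ T (adjoin hσ h₀ y) where
  stable := by
    intro p q h
    rw [adjoin, Setoid.ker_def] at h ⊢
    rw [adjoin_equivariant hy, adjoin_equivariant hy, h]
  separates := by
    intro s t hs ht h
    rw [adjoin, Setoid.ker_def,
      extend_rest (⟨s, ne_of_mem hT hσ hx hs⟩ : Rest σ x),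
      extend_rest (⟨t, ne_of_mem hT hσ hx ht⟩ : Rest σ x), Sum.inl.injEq, mk_eq_mk] at h
    exact congrArg Subtype.val (h₀.separates (s := ⟨s, _⟩) (t := ⟨t, _⟩) hs ht h)

lemma comap_adjoin : Setoid.comap Subtype.val (adjoin hσ h₀ y) = e₀ := by
  rw [adjoin, comap_ker_extend]
  ext p q
  rw [Setoid.ker_def, Sum.inl.injEq, mk_eq_mk]

lemma adjoin_rest_iff (q : Rest σ x) :
    adjoin hσ h₀ y q x ↔ y = Sum.inl (Quotient.mk e₀ q) := by
  rw [adjoin, Setoid.ker_def, extend_rest, extend_self, eq_comm]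

lemma adjoin_invol_iff (hy : σ x = x → pointInvol hσ h₀ y = y) :
    adjoin hσ h₀ y (σ x) x ↔ pointInvol hσ h₀ y = y := by
  rw [adjoin, Setoid.ker_def, extend_invol hy, extend_self]

lemma adjoin_eq (hy : σ x = x → pointInvol hσ h₀ y = y) {e : Setoid Q}
    (he : IsAdmissible σ T e) (he₀ : e₀ = Setoid.comap Subtype.val e)
    (h2 : ∀ q : Rest σ x, y = Sum.inl (Quotient.mk e₀ q) ↔ e q x)
    (h3 : pointInvol hσ h₀ y = y ↔ e (σ x) x) : adjoin hσ h₀ y = e := by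
  refine ker_extend hσ (pointInvol_involutive hσ h₀) (fun _ => rfl) hy he.stable
    (fun p q => ?_) (fun q => eq_comm.trans (h2 q)) h3
  rw [Sum.inl.injEq, mk_eq_mk, he₀]
  rfl

lemma isAdmissible_comap {e : Setoid Q} (he : IsAdmissible σ T e) :
    IsAdmissible (restInvol hσ x) (Subtype.val ⁻¹' T) (Setoid.comap Subtype.val e) where
  stable h := he.stable h
  separates hs ht h := Subtype.ext (he.separates hs ht h)

lemma range_adjoin (hy : σ x = x → pointInvol hσ h₀ y = y) :
    Set.range (extend σ (pointInvol hσ h₀) x (fun q => Sum.inl (Quotient.mk e₀ q)) y) =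
      Set.range Sum.inl ∪ {y, pointInvol hσ h₀ y} := by
  rw [range_extend hy]
  congr 1
  exact Quotient.mk_surjective.range_comp Sum.inl

lemma image_adjoin (hT : ∀ t ∈ T, σ t ∈ T) (hx : x ∉ T) :
    extend σ (pointInvol hσ h₀) x (fun q => Sum.inl (Quotient.mk e₀ q)) y '' T =
      Sum.inl '' (Quotient.mk e₀ '' (Subtype.val ⁻¹' T)) := by
  ext z
  constructor
  · rintro ⟨t, ht, rfl⟩
    exact ⟨_, ⟨⟨t, ne_of_mem hT hσ hx ht⟩, ht, rfl⟩,
      (extend_rest (g := fun q => Sum.inl (Quotient.mk e₀ q))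
        (⟨t, ne_of_mem hT hσ hx ht⟩ : Rest σ x)).symm⟩
  · rintro ⟨_, ⟨t, ht, rfl⟩, rfl⟩
    exact ⟨t, ht, extend_rest t⟩

/-- The classes are the points hit by the extended map: all old classes, plus the new points among
`y` and its image. Points of `T` only hit old classes, so the new ones always count. -/
lemma numFree_adjoin [Finite Q] (hT : ∀ t ∈ T, σ t ∈ T) (hx : x ∉ T)
    (hy : σ x = x → pointInvol hσ h₀ y = y) : numFree σ T (adjoin hσ h₀ y) =
      numFree (restInvol hσ x) (Subtype.val ⁻¹' T) e₀ +
        {o : Option Bool | o.map not ≠ o ∧ (Sum.inr o = y ∨ Sum.inr o = pointInvol hσ h₀ y)}.ncard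
    := by
  rw [adjoin, numFree_ker (adjoin_equivariant hy), range_adjoin hy, image_adjoin hT hx,
    numFree_eq h₀,
    ← Set.ncard_image_of_injective {c : Quotient e₀ | _} (Sum.inl_injective (β := Option Bool)),
    ← Set.ncard_image_of_injective {o : Option Bool | _} (Sum.inr_injective (α := Quotient e₀)),
    ← Set.ncard_union_eq _ (Set.toFinite _) (Set.toFinite _)]
  · congr 1
    ext (c | o) <;> simp [pointInvol]
    tauto
  · rw [Set.disjoint_left]
    rintro _ ⟨c, _, rfl⟩ ⟨o, _, h⟩
    cases h

lemma numFixed_adjoin [Finite Q] (hT : ∀ t ∈ T, σ t ∈ T) (hx : x ∉ T)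
    (hy : σ x = x → pointInvol hσ h₀ y = y) : numFixed σ T (adjoin hσ h₀ y) =
      numFixed (restInvol hσ x) (Subtype.val ⁻¹' T) e₀ +
        {o : Option Bool | o.map not = o ∧ (Sum.inr o = y ∨ Sum.inr o = pointInvol hσ h₀ y)}.ncard
    := by
  rw [adjoin, numFixed_ker (adjoin_equivariant hy), range_adjoin hy, image_adjoin hT hx,
    numFixed_eq h₀,
    ← Set.ncard_image_of_injective {c : Quotient e₀ | _} (Sum.inl_injective (β := Option Bool)),
    ← Set.ncard_image_of_injective {o : Option Bool | _} (Sum.inr_injective (α := Quotient e₀)),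
    ← Set.ncard_union_eq _ (Set.toFinite _) (Set.toFinite _)]
  · congr 1
    ext (c | o) <;> simp [pointInvol]
    tauto
  · rw [Set.disjoint_left]
    rintro _ ⟨c, _, rfl⟩ ⟨o, _, h⟩
    cases h

end Adjoin
end Z2Setoid

/-! ### The recursion for sums of weights -/

namespace Z2Setoid

instance finite_setoid {Q : Type} [Finite Q] : Finite (Setoid Q) :=
  Finite.of_injective (fun (e : Setoid Q) x y => e x y) fun _ _ h =>
    Setoid.ext fun x y => iff_of_eq (congrFun (congrFun h x) y)

/-- The sum of the weights of the admissible equivalence relations. -/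
noncomputable def weightSum {Q : Type} (σ : Q → Q) (T : Set Q) (w : ℕ → ℕ → ℕ) : ℕ :=
  ∑ᶠ e : {e : Setoid Q // IsAdmissible σ T e}, w (numFree σ T e) (numFixed σ T e)

section Step

variable {Q : Type} {σ : Q → Q} (hσ : Function.Involutive σ) {T : Set Q} {x : Q}

/-- If the admissible relations are the bijective images of `adjoin` on the points of a family
`C`, then their weights sum up accordingly. -/
lemma weightSum_eq_sum_adjoin (hT : ∀ t ∈ T, σ t ∈ T) (hx : x ∉ T)
    {C : {e₀ : Setoid (Rest σ x) //
      IsAdmissible (restInvol hσ x) (Subtype.val ⁻¹' T) e₀} → Type}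
    (point : ∀ e₀, C e₀ → Quotient e₀.1 ⊕ Option Bool)
    (hpoint : ∀ e₀ c, σ x = x → pointInvol hσ e₀.2 (point e₀ c) = point e₀ c)
    (hinj : ∀ e₀ c c', (∀ q, point e₀ c = Sum.inl q ↔ point e₀ c' = Sum.inl q) →
      (pointInvol hσ e₀.2 (point e₀ c) = point e₀ c ↔
        pointInvol hσ e₀.2 (point e₀ c') = point e₀ c') → c = c')
    (hsurj : ∀ (e : Setoid Q) (he : IsAdmissible σ T e),
      ∃ c, (∀ q : Rest σ x, point ⟨_, isAdmissible_comap he⟩ c = Sum.inl (Quotient.mk _ q) ↔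
        e q x) ∧ (pointInvol hσ (isAdmissible_comap he) (point ⟨_, isAdmissible_comap he⟩ c) =
          point ⟨_, isAdmissible_comap he⟩ c ↔ e (σ x) x))
    (w : ℕ → ℕ → ℕ) : weightSum σ T w = ∑ᶠ p : Σ e₀, C e₀,
      w (numFree σ T (adjoin hσ p.1.2 (point p.1 p.2)))
        (numFixed σ T (adjoin hσ p.1.2 (point p.1 p.2))) := by
  let f : (Σ e₀, C e₀) → {e : Setoid Q // IsAdmissible σ T e} := fun p =>
    ⟨adjoin hσ p.1.2 (point p.1 p.2), isAdmissible_adjoin hT hx (hpoint p.1 p.2)⟩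
  have hf : Function.Bijective f := by
    constructor
    · rintro ⟨⟨e₀, h₀⟩, c⟩ ⟨⟨e₁, h₁⟩, c'⟩ h
      have h' : adjoin hσ h₀ (point ⟨e₀, h₀⟩ c) = adjoin hσ h₁ (point ⟨e₁, h₁⟩ c') :=
        congrArg Subtype.val h
      -- The relation on the complement is recovered by restriction.
      have h01 : e₀ = e₁ := by
        rw [← comap_adjoin (hσ := hσ) (h₀ := h₀), h', comap_adjoin]
      subst h01
      have : c = c' := by
        apply hinj
        · intro q
          induction q using Quotient.inductionOn with
          | h q => rw [← adjoin_rest_iff (hσ := hσ) (h₀ := h₀), h', adjoin_rest_iff]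
        · rw [← adjoin_invol_iff (hpoint _ c), h', adjoin_invol_iff (hpoint _ c')]
      rw [this]
    · rintro ⟨e, he⟩
      obtain ⟨c, h2, h3⟩ := hsurj e he
      exact ⟨⟨_, c⟩, Subtype.ext (adjoin_eq (hpoint _ c) he rfl h2 h3)⟩
  exact (finsum_comp (g := fun e : {e : Setoid Q // IsAdmissible σ T e} =>
    w (numFree σ T e) (numFixed σ T e)) f hf).symm

lemma ncard_rest {S : Set Q} (hS : ∀ s ∈ S, s ≠ x ∧ s ≠ σ x) :
    (Subtype.val ⁻¹' S : Set (Rest σ x)).ncard = S.ncard :=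
  Set.ncard_preimage_of_injective_subset_range Subtype.val_injective
    fun s hs => ⟨⟨s, hS s hs⟩, rfl⟩

/-- The point `x` may join any old class, counted by `card_quotient`, or the orbit forms two free
classes or one fixed class. -/
lemma weightSum_of_invol_ne [Finite Q] (hT : ∀ t ∈ T, σ t ∈ T) (hx : x ∉ T) (hxσ : σ x ≠ x)
    (w : ℕ → ℕ → ℕ) :
    weightSum σ T w = weightSum (restInvol hσ x) (Subtype.val ⁻¹' T)
      ((freeOp + (fixedOp + (T.ncard : Module.End ℕ (ℕ → ℕ → ℕ)))) w) := by
  classical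
  -- `some true` and `some false` are swapped by the involution and `none` is fixed. Sending `x` to
  -- `some false` would give the same relation as `some true`, so only one of them is used.
  rw [weightSum_eq_sum_adjoin hσ hT hx (C := fun e₀ => Quotient e₀.1 ⊕ Bool)
    (fun _ => Sum.map id (fun b => bif b then some true else none))
    (fun _ _ h => absurd h hxσ)]
  · rw [weightSum]
    have := Fintype.ofFinite {e₀ : Setoid (Rest σ x) //
      IsAdmissible (restInvol hσ x) (Subtype.val ⁻¹' T) e₀}
    have (e₀ : {e₀ : Setoid (Rest σ x) //
      IsAdmissible (restInvol hσ x) (Subtype.val ⁻¹' T) e₀}) := Fintype.ofFinite (Quotient e₀.1)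
    rw [finsum_eq_sum_of_fintype, finsum_eq_sum_of_fintype, Fintype.sum_sigma]
    refine Finset.sum_congr rfl fun e₀ _ => ?_
    have hc := ncard_rest (σ := σ) fun t ht => ne_of_mem hT hσ hx ht
    rw [Fintype.sum_sum_type, Fintype.sum_bool]
    simp only [numFree_adjoin hT hx (fun h => absurd h hxσ),
      numFixed_adjoin hT hx (fun h => absurd h hxσ)]
    have e1 : {o : Option Bool | ¬ (o.map not = o) ∧ (o = some true ∨ o = some false)}.ncard = 2 := by
      have : {o : Option Bool | ¬ (o.map not = o) ∧ (o = some true ∨ o = some false)} =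
          {some true, some false} := by
        ext (_ | _ | _) <;> simp
      rw [this, Set.ncard_pair (by simp)]
    have e2 : {o : Option Bool | o.map not = o ∧ (o = some true ∨ o = some false)}.ncard = 0 := by
      have : {o : Option Bool | o.map not = o ∧ (o = some true ∨ o = some false)} = ∅ := by
        ext (_ | _ | _) <;> simp
      rw [this, Set.ncard_empty]
    have e3 : {o : Option Bool | ¬ (o.map not = o) ∧ o = none}.ncard = 0 := by
      have : {o : Option Bool | ¬ (o.map not = o) ∧ o = none} = ∅ := by
        ext (_ | _ | _) <;> simp
      rw [this, Set.ncard_empty]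
    have e4 : {o : Option Bool | o.map not = o ∧ o = none}.ncard = 1 := by
      have : {o : Option Bool | o.map not = o ∧ o = none} = {none} := by
        ext (_ | _ | _) <;> simp
      rw [this, Set.ncard_singleton]
    simp [pointInvol, e1, e2, e3, e4, ← Nat.card_eq_fintype_card, card_quotient e₀.2,
      freeOp_apply, fixedOp_apply, hc]
    ring
  · rintro e₀ (c | _ | _) (c' | _ | _) h1 h2 <;> simp_all [pointInvol]
  · intro e he
    by_cases h : ∃ q : Rest σ x, e q x
    · obtain ⟨q, hq⟩ := h
      refine ⟨Sum.inl (Quotient.mk _ q), fun p => ?_, ?_⟩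
      · simp only [Sum.map_inl, id, Sum.inl.injEq]
        rw [mk_eq_mk, Setoid.comap_rel]
        exact ⟨fun h => e.trans' (e.symm' h) hq, fun h => e.trans' hq (e.symm' h)⟩
      · simp only [Sum.map_inl, id, Sum.inl.injEq, pointInvol, classInvol_mk]
        rw [mk_eq_mk, Setoid.comap_rel]
        have := he.stable hq
        exact ⟨fun h => e.trans' (e.symm' this) (e.trans' h hq),
          fun h => e.trans' this (e.trans' h (e.symm' hq))⟩
    · push Not at h
      by_cases h' : e (σ x) x
      · exact ⟨Sum.inr false, by simp [h], by simp [pointInvol, h']⟩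
      · exact ⟨Sum.inr true, by simp [h], by simp [pointInvol, h']⟩

/-- A fixed point can only join a fixed class, counted by `ncard_fixed_classes`, or be a new fixed
class by itself. -/
lemma weightSum_of_invol_eq [Finite Q] (hT : ∀ t ∈ T, σ t ∈ T) (hx : x ∉ T) (hxσ : σ x = x)
    (w : ℕ → ℕ → ℕ) :
    weightSum σ T w = weightSum (restInvol hσ x) (Subtype.val ⁻¹' T)
      ((fixedOp + ({t | t ∈ T ∧ σ t = t}.ncard : Module.End ℕ (ℕ → ℕ → ℕ))) w) := by
  classical
  have hp (e₀ : {e₀ : Setoid (Rest σ x) //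
      IsAdmissible (restInvol hσ x) (Subtype.val ⁻¹' T) e₀})
      (c : {c // classInvol e₀.2 c = c} ⊕ Unit) (_ : σ x = x) :
      pointInvol hσ e₀.2 (Sum.map Subtype.val (fun _ => none) c) =
        Sum.map Subtype.val (fun _ => none) c := by
    rcases c with ⟨c, hc⟩ | _
    · simp [pointInvol, hc]
    · simp [pointInvol]
  rw [weightSum_eq_sum_adjoin hσ hT hx (C := fun e₀ => {c // classInvol e₀.2 c = c} ⊕ Unit)
    (fun _ => Sum.map Subtype.val (fun _ => none)) hp]
  · rw [weightSum]
    have := Fintype.ofFinite {e₀ : Setoid (Rest σ x) //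
      IsAdmissible (restInvol hσ x) (Subtype.val ⁻¹' T) e₀}
    have (e₀ : {e₀ : Setoid (Rest σ x) //
      IsAdmissible (restInvol hσ x) (Subtype.val ⁻¹' T) e₀}) :=
        Fintype.ofFinite {c // classInvol e₀.2 c = c}
    rw [finsum_eq_sum_of_fintype, finsum_eq_sum_of_fintype, Fintype.sum_sigma]
    refine Finset.sum_congr rfl fun e₀ _ => ?_
    have hc : Nat.card {c // classInvol e₀.2 c = c} =
        numFixed (restInvol hσ x) (Subtype.val ⁻¹' T) e₀ + {t | t ∈ T ∧ σ t = t}.ncard := by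
      rw [← ncard_rest (σ := σ) fun t ht => ne_of_mem hT hσ hx ht.1]
      have := ncard_fixed_classes (σ := restInvol hσ x) (fun t ht => hT t ht) e₀.2
      simp only [restInvol, Subtype.ext_iff] at this
      exact this
    rw [Fintype.sum_sum_type]
    simp only [numFree_adjoin hT hx (hp e₀ _), numFixed_adjoin hT hx (hp e₀ _)]
    have e3 : {o : Option Bool | ¬ (o.map not = o) ∧ o = none}.ncard = 0 := by
      have : {o : Option Bool | ¬ (o.map not = o) ∧ o = none} = ∅ := by
        ext (_ | _ | _) <;> simp
      rw [this, Set.ncard_empty]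
    have e4 : {o : Option Bool | o.map not = o ∧ o = none}.ncard = 1 := by
      have : {o : Option Bool | o.map not = o ∧ o = none} = {none} := by
        ext (_ | _ | _) <;> simp
      rw [this, Set.ncard_singleton]
    simp [pointInvol, e3, e4, ← Nat.card_eq_fintype_card, hc, fixedOp_apply]
    ring
  · rintro e₀ (⟨c, _⟩ | _) (⟨c', _⟩ | _) h1 h2 <;> simp_all [pointInvol]
  · intro e he
    by_cases h : ∃ q : Rest σ x, e q x
    · obtain ⟨q, hq⟩ := h
      have hσq : e (σ q) q := by
        have hq' : e (σ q) x := hxσ.subst (motive := fun y => e (σ q) y) (he.stable hq)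
        exact e.trans' hq' (e.symm' hq)
      refine ⟨Sum.inl ⟨Quotient.mk _ q, ?_⟩, fun p => ?_, ?_⟩
      · rw [classInvol_mk, mk_eq_mk]
        exact hσq
      · simp only [Sum.map_inl, Sum.inl.injEq]
        rw [mk_eq_mk, Setoid.comap_rel]
        exact ⟨fun h => e.trans' (e.symm' h) hq, fun h => e.trans' hq (e.symm' h)⟩
      · simp only [Sum.map_inl, Sum.inl.injEq, pointInvol, classInvol_mk, hxσ]
        rw [mk_eq_mk, Setoid.comap_rel]
        exact iff_of_true hσq (e.refl' _)
    · push Not at h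
      refine ⟨Sum.inr (), by simp [h], by simp [pointInvol, hxσ]⟩

end Step

/-- Separating all points leaves only equality, which has no class off `T`. -/
lemma weightSum_of_forall_mem {Q : Type} {σ : Q → Q} {T : Set Q} (hT : ∀ q, q ∈ T)
    (w : ℕ → ℕ → ℕ) : weightSum σ T w = w 0 0 := by
  have hbot : IsAdmissible σ T ⊥ := ⟨fun h => congrArg σ h, fun _ _ h => h⟩
  have hu (e : {e : Setoid Q // IsAdmissible σ T e}) : e = ⟨⊥, hbot⟩ := by
    refine Subtype.ext (Setoid.ext fun x y => ⟨fun h => e.2.separates (hT x) (hT y) h, ?_⟩)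
    rintro rfl
    exact e.1.refl' _
  have : Unique {e : Setoid Q // IsAdmissible σ T e} := ⟨⟨⟨⊥, hbot⟩⟩, hu⟩
  rw [weightSum, finsum_unique]
  have h1 : numFree σ T (default : {e : Setoid Q // IsAdmissible σ T e}).1 = 0 := by
    rw [numFree, show {x | _ ∧ ∀ t ∈ T, ¬ _} = (∅ : Set Q) from
      Set.eq_empty_of_forall_notMem fun x hx => hx.2 x (hT x) (Setoid.refl' _ x),
      Set.image_empty, Set.ncard_empty]
  have h2 : numFixed σ T (default : {e : Setoid Q // IsAdmissible σ T e}).1 = 0 := by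
    rw [numFixed, show {x | _ ∧ ∀ t ∈ T, ¬ _} = (∅ : Set Q) from
      Set.eq_empty_of_forall_notMem fun x hx => hx.2 x (hT x) (Setoid.refl' _ x),
      Set.image_empty, Set.ncard_empty]
  rw [h1, h2]

/-- The weights of the admissible equivalence relations sum up to the value at the origin of a
product of counting operators. -/
theorem weightSum_eq {t s : ℕ} (r₁ r₂ : ℕ) {Q : Type} [Finite Q] {σ : Q → Q}
    (hσ : Function.Involutive σ) {T : Set Q} (hT : ∀ q ∈ T, σ q ∈ T) (ht : T.ncard = t)
    (hs : {q | q ∈ T ∧ σ q = q}.ncard = s) (hr₁ : {q | q ∉ T ∧ σ q ≠ q}.ncard = 2 * r₁)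
    (hr₂ : {q | q ∉ T ∧ σ q = q}.ncard = r₂) (w : ℕ → ℕ → ℕ) :
    weightSum σ T w = ((fixedOp + (s : Module.End ℕ (ℕ → ℕ → ℕ))) ^ r₂ *
      (freeOp + (fixedOp + (t : Module.End ℕ (ℕ → ℕ → ℕ)))) ^ r₁) w 0 0 := by
  induction r₁ generalizing Q w with
  | zero =>
    rw [pow_zero, mul_one]
    have hfix : ∀ q ∉ T, σ q = q := by
      intro q hq
      by_contra h
      rw [mul_zero, Set.ncard_eq_zero] at hr₁
      exact Set.notMem_empty q (hr₁ ▸ ⟨hq, h⟩)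
    clear hr₁
    induction r₂ generalizing Q w with
    | zero =>
      rw [Set.ncard_eq_zero] at hr₂
      rw [weightSum_of_forall_mem, pow_zero, Module.End.one_apply]
      intro q
      by_contra hq
      exact Set.notMem_empty q (hr₂ ▸ ⟨hq, hfix q hq⟩)
    | succ r ih =>
      obtain ⟨x, hx, hxσ⟩ : {q | q ∉ T ∧ σ q = q}.Nonempty :=
        Set.nonempty_of_ncard_ne_zero (by omega)
      rw [weightSum_of_invol_eq hσ hT hx hxσ, hs, pow_succ, Module.End.mul_apply]
      refine ih (T := Subtype.val ⁻¹' T) (restInvol_involutive hσ x) (fun q hq => hT q hq)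
        ?_ ?_ ?_ _ ?_
      · rw [← ht]
        exact ncard_rest fun t ht => ne_of_mem hT hσ hx ht
      · rw [← hs, ← ncard_rest (σ := σ) fun t ht => ne_of_mem hT hσ hx ht.1]
        simp only [restInvol, Subtype.ext_iff]
        rfl
      · have h : {q | q ∉ T ∧ σ q = q} \ {x} =
            Subtype.val '' {q : Rest σ x | q ∉ (Subtype.val ⁻¹' T : Set (Rest σ x)) ∧
              restInvol hσ x q = q} := by
          ext q
          constructor
          · rintro ⟨⟨h1, h2⟩, h3⟩
            exact ⟨⟨q, h3, fun h => h3 (h.trans hxσ)⟩, ⟨h1, Subtype.ext h2⟩, rfl⟩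
          · rintro ⟨q, ⟨h1, h2⟩, rfl⟩
            exact ⟨⟨h1, congrArg Subtype.val h2⟩, q.2.1⟩
        have hmem : x ∈ {q | q ∉ T ∧ σ q = q} := ⟨hx, hxσ⟩
        rw [← Set.ncard_image_of_injective _ Subtype.val_injective, ← h,
          Set.ncard_sdiff_singleton_of_mem hmem, hr₂, Nat.add_sub_cancel]
      · exact fun q hq => Subtype.ext (hfix q hq)
  | succ r ih =>
    obtain ⟨x, hx, hxσ⟩ : {q | q ∉ T ∧ σ q ≠ q}.Nonempty :=
      Set.nonempty_of_ncard_ne_zero (by omega)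
    -- The operator of the removed orbit acts first on `w`, so the induction has to run over all
    -- weights.
    rw [weightSum_of_invol_ne hσ hT hx hxσ, ht, pow_succ, ← mul_assoc, Module.End.mul_apply]
    refine ih (T := Subtype.val ⁻¹' T) (restInvol_involutive hσ x) (fun q hq => hT q hq)
      ?_ ?_ ?_ ?_ _
    · rw [← ht]
      exact ncard_rest fun t ht => ne_of_mem hT hσ hx ht
    · rw [← hs, ← ncard_rest (σ := σ) fun t ht => ne_of_mem hT hσ hx ht.1]
      simp only [restInvol, Subtype.ext_iff]
      rfl
    · have h : ({q | q ∉ T ∧ σ q ≠ q} \ {x}) \ {σ x} =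
          Subtype.val '' {q : Rest σ x | q ∉ (Subtype.val ⁻¹' T : Set (Rest σ x)) ∧
            restInvol hσ x q ≠ q} := by
        ext q
        constructor
        · rintro ⟨⟨⟨h1, h2⟩, h3⟩, h4⟩
          exact ⟨⟨q, h3, h4⟩, ⟨h1, fun h => h2 (congrArg Subtype.val h)⟩, rfl⟩
        · rintro ⟨q, ⟨h1, h2⟩, rfl⟩
          exact ⟨⟨⟨h1, fun h => h2 (Subtype.ext h)⟩, q.2.1⟩, q.2.2⟩
      have hσx : σ x ∉ T := fun h => hx (hσ x ▸ hT _ h)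
      have hσx' : σ (σ x) ≠ σ x := by rw [hσ]; exact hxσ.symm
      have hmem : x ∈ {q | q ∉ T ∧ σ q ≠ q} := ⟨hx, hxσ⟩
      have hmem' : σ x ∈ {q | q ∉ T ∧ σ q ≠ q} \ {x} := ⟨⟨hσx, hσx'⟩, hxσ⟩
      rw [← Set.ncard_image_of_injective _ Subtype.val_injective, ← h,
        Set.ncard_sdiff_singleton_of_mem hmem',
        Set.ncard_sdiff_singleton_of_mem hmem, hr₁]
      omega
    · rw [← hr₂, ← ncard_rest (σ := σ) (x := x) (S := {q | q ∉ T ∧ σ q = q})]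
      · simp only [restInvol, Subtype.ext_iff]
        rfl
      · rintro q ⟨_, h2⟩
        exact ⟨fun h => hxσ (h ▸ h2), fun h => hxσ (by rw [h, hσ] at h2; exact h2.symm)⟩

/-- The number of admissible equivalence relations with prescribed numbers of classes. -/
theorem ncard_isAdmissible {t s r₁ r₂ : ℕ} {Q : Type} [Finite Q] {σ : Q → Q}
    (hσ : Function.Involutive σ) {T : Set Q} (hT : ∀ q ∈ T, σ q ∈ T) (ht : T.ncard = t)
    (hs : {q | q ∈ T ∧ σ q = q}.ncard = s) (hr₁ : {q | q ∉ T ∧ σ q ≠ q}.ncard = 2 * r₁)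
    (hr₂ : {q | q ∉ T ∧ σ q = q}.ncard = r₂) (p₁ p₂ : ℕ) :
    {e | IsAdmissible σ T e ∧ numFree σ T e = 2 * p₁ ∧ numFixed σ T e = p₂}.ncard =
      count t s r₁ r₂ p₁ p₂ := by
  classical
  rw [count, ← weightSum_eq r₁ r₂ hσ hT ht hs hr₁ hr₂, weightSum]
  have := Fintype.ofFinite {e : Setoid Q // IsAdmissible σ T e}
  rw [finsum_eq_sum_of_fintype]
  simp only [indicator]
  -- With the indicator as weight, the sum of weights is a cardinality.
  rw [Finset.sum_boole, Nat.cast_id, ← Set.ncard_coe_finset,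
    ← Set.ncard_image_of_injective _ Subtype.val_injective]
  congr 1
  ext e
  simp only [Finset.coe_filter, Finset.mem_univ, true_and, Set.mem_image, Set.mem_ofPred_eq,
    Subtype.exists, exists_and_right, exists_eq_right, exists_prop]
  tauto

end Z2Setoid

/-! ### Two-row diagrams with an involution on the vertices -/

namespace TwoRow

section Rows

variable {X : Type} {d d' : Setoid (X ⊕ X)}

/-- The equivalence relation on the top row. -/
abbrev row (d : Setoid (X ⊕ X)) : Setoid X := Setoid.comap Sum.inl d

/-- The vertices that are joined to their copies. -/
def through (d : Setoid (X ⊕ X)) : Set X := {x | d (Sum.inl x) (Sum.inr x)}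

lemma mem_through {x : X} : x ∈ through d ↔ d (Sum.inl x) (Sum.inr x) := Iff.rfl

lemma IsDoubled.rel_inr_inr (hd : IsDoubled d) {x y : X} :
    d (Sum.inr x) (Sum.inr y) ↔ row d x y := (hd.1 x y).symm

/-- This is why a doubled diagram amounts to its top row together with the vertices in through
classes. -/
lemma IsDoubled.rel_inl_inr (hd : IsDoubled d) {x y : X} :
    d (Sum.inl x) (Sum.inr y) ↔ row d x y ∧ x ∈ through d := by
  constructor
  · intro h
    have hx := hd.2 x y h
    exact ⟨(hd.1 x y).2 (d.trans' (d.symm' hx) h), hx⟩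
  · rintro ⟨h, hx⟩
    exact d.trans' hx ((hd.1 x y).1 h)

lemma IsDoubled.mem_through_of_rel (hd : IsDoubled d) {x y : X} (h : row d x y)
    (hx : x ∈ through d) : y ∈ through d :=
  d.trans' (d.symm' h) (hd.rel_inl_inr.2 ⟨h, hx⟩)

lemma IsDoubled.mem_through_iff (hd : IsDoubled d) {x y : X} (h : row d x y) :
    x ∈ through d ↔ y ∈ through d :=
  ⟨hd.mem_through_of_rel h, hd.mem_through_of_rel ((row d).symm' h)⟩

lemma IsDoubled.ext (hd : IsDoubled d) (hd' : IsDoubled d')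
    (h : ∀ x y, row d x y ↔ row d' x y) (ht : through d = through d') : d = d' := by
  ext (x | x) (y | y)
  · exact h x y
  · rw [hd.rel_inl_inr, hd'.rel_inl_inr, h, ht]
  · rw [d.comm', d'.comm', hd.rel_inl_inr, hd'.rel_inl_inr, h, ht]
  · rw [hd.rel_inr_inr, hd'.rel_inr_inr, h]

/-- The connected component of a vertex. -/
def component (d : Setoid (X ⊕ X)) (p : X ⊕ X) : Set (X ⊕ X) := {q | d q p}

lemma component_mem_classes (p : X ⊕ X) : component d p ∈ d.classes := d.mem_classes p

lemma mem_classes_iff {C : Set (X ⊕ X)} : C ∈ d.classes ↔ ∃ p, C = component d p := Iff.rfl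

lemma component_eq_iff {p q : X ⊕ X} : component d p = component d q ↔ d p q := by
  constructor
  · intro h
    have : p ∈ component d p := d.refl' p
    rwa [h] at this
  · intro h
    ext r
    exact ⟨fun hr => d.trans' hr h, fun hr => d.trans' hr (d.symm' h)⟩

lemma IsDoubled.isThroughClass_iff (hd : IsDoubled d) {C : Set (X ⊕ X)} :
    IsThroughClass d C ↔ ∃ x ∈ through d, C = component d (Sum.inl x) := by
  constructor
  · rintro ⟨hC, ⟨x, hx⟩, ⟨y, hy⟩⟩
    obtain ⟨p, rfl⟩ := mem_classes_iff.1 hC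
    exact ⟨x, hd.2 x y (d.trans' hx (d.symm' hy)), component_eq_iff.2 (d.symm' hx)⟩
  · rintro ⟨x, hx, rfl⟩
    exact ⟨component_mem_classes _, ⟨x, d.refl' _⟩, ⟨x, d.symm' hx⟩⟩

lemma IsDoubled.isTopEdge_iff (hd : IsDoubled d) {C : Set (X ⊕ X)} :
    IsTopEdge d C ↔ ∃ x ∉ through d, C = component d (Sum.inl x) := by
  constructor
  · rintro ⟨hC, hr⟩
    obtain ⟨p, rfl⟩ := mem_classes_iff.1 hC
    obtain ⟨x, rfl⟩ := hr (show p ∈ component d p from d.refl' p)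
    refine ⟨x, fun hx => ?_, rfl⟩
    obtain ⟨y, hy⟩ := hr (show Sum.inr x ∈ component d (Sum.inl x) from d.symm' hx)
    cases hy
  · rintro ⟨x, hx, rfl⟩
    refine ⟨component_mem_classes _, ?_⟩
    rintro (y | y) hy
    · exact ⟨y, rfl⟩
    · exact absurd (hd.2 x y (d.symm' hy)) hx

lemma IsDoubled.isBottomEdge_iff (hd : IsDoubled d) {C : Set (X ⊕ X)} :
    IsBottomEdge d C ↔ ∃ x ∉ through d, C = component d (Sum.inr x) := by
  constructor
  · rintro ⟨hC, hr⟩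
    obtain ⟨p, rfl⟩ := mem_classes_iff.1 hC
    obtain ⟨x, rfl⟩ := hr (show p ∈ component d p from d.refl' p)
    refine ⟨x, fun hx => ?_, rfl⟩
    obtain ⟨y, hy⟩ := hr (show Sum.inl x ∈ component d (Sum.inr x) from hx)
    cases hy
  · rintro ⟨x, hx, rfl⟩
    refine ⟨component_mem_classes _, ?_⟩
    rintro (y | y) hy
    · obtain ⟨h, hy'⟩ := hd.rel_inl_inr.1 hy
      exact absurd (hd.mem_through_of_rel h hy') hx
    · exact ⟨y, rfl⟩

/-- The doubled diagram with given top row and given vertices in through classes. -/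
def double (e : Setoid X) (S : Set X) : Setoid (X ⊕ X) :=
  Setoid.ker (Sum.elim (fun x => (Quotient.mk e x, True)) (fun x => (Quotient.mk e x, x ∈ S)))

section Double

variable {e : Setoid X} {S : Set X}

lemma double_iff (p q : X ⊕ X) : double e S p q ↔
    Sum.elim (fun x => (Quotient.mk e x, True)) (fun x => (Quotient.mk e x, x ∈ S)) p =
      Sum.elim (fun x => (Quotient.mk e x, True)) (fun x => (Quotient.mk e x, x ∈ S)) q :=
  Iff.rfl

lemma row_double (x y : X) : row (double e S) x y ↔ e x y := by
  rw [Setoid.comap_rel, double_iff]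
  simp [Z2Setoid.mk_eq_mk]

lemma through_double : through (double e S) = S := by
  ext x
  rw [mem_through, double_iff]
  simp

/-- Two bottom vertices get equal labels when they lie in the same class and agree on membership in
`S`; saturation of `S` makes the second condition automatic. -/
lemma isDoubled_double (hS : ∀ x y, e x y → (x ∈ S ↔ y ∈ S)) : IsDoubled (double e S) := by
  constructor
  · intro x y
    rw [double_iff, double_iff]
    simp only [Sum.elim_inl, Sum.elim_inr, Prod.mk.injEq, Z2Setoid.mk_eq_mk, and_true]
    exact ⟨fun h => ⟨h, propext (hS x y h)⟩, fun h => h.1⟩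
  · intro x y
    rw [double_iff, double_iff]
    simp only [Sum.elim_inl, Sum.elim_inr, Prod.mk.injEq, Z2Setoid.mk_eq_mk, true_and]
    exact fun h => (eq_true ((hS x y h.1).2 (of_eq_true h.2.symm))).symm

end Double

end Rows

/-! ### Stable diagrams for an arbitrary involution -/

section Invol

variable {X : Type} (σ : X → X) (d d' : Setoid (X ⊕ X))

/-- Stability under an involution of the vertices of a row. -/
def IsStable : Prop :=
  ∀ p q : X ⊕ X, d p q → d (Sum.map σ σ p) (Sum.map σ σ q)

/-- A component that never contains both a vertex and its image. -/
def IsEClass (C : Set (X ⊕ X)) : Prop :=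
  C ∈ d.classes ∧ ∀ p ∈ C, Sum.map σ σ p ∉ C

/-- A component that contains with each vertex its image. -/
def IsZ2Class (C : Set (X ⊕ X)) : Prop :=
  C ∈ d.classes ∧ ∀ p ∈ C, Sum.map σ σ p ∈ C

/-- The doubled stable diagrams with given numbers of through classes. -/
def J (s₁ s₂ : ℕ) : Set (Setoid (X ⊕ X)) :=
  {d | IsStable σ d ∧ IsDoubled d ∧
    {C | IsThroughClass d C ∧ IsEClass σ d C}.ncard = 2 * s₁ ∧
    {C | IsThroughClass d C ∧ IsZ2Class σ d C}.ncard = s₂}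

/-- The number of horizontal edges of the top row that are not preserved. -/
noncomputable def numEEdges : ℕ :=
  {C | IsTopEdge d C ∧ IsEClass σ d C}.ncard

/-- The number of horizontal edges of the top row that are preserved. -/
noncomputable def numZ2Edges : ℕ :=
  {C | IsTopEdge d C ∧ IsZ2Class σ d C}.ncard

/-- `d'` is coarser than `d`. -/
def IsCoarser : Prop :=
  (∀ C, IsThroughClass d C → IsEClass σ d C →
    ∃ C', IsThroughClass d' C' ∧ IsEClass σ d' C' ∧ C ⊆ C') ∧
  (∀ C, IsThroughClass d C → IsZ2Class σ d C →
    ∃ C', IsThroughClass d' C' ∧ IsZ2Class σ d' C' ∧ C ⊆ C') ∧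
  (∀ C, IsHorizontalEdge d C → IsEClass σ d C →
    ∃ C', (IsHorizontalEdge d' C' ∨ IsThroughClass d' C') ∧
      (IsEClass σ d' C' ∨ IsZ2Class σ d' C') ∧ C ⊆ C') ∧
  (∀ C, IsHorizontalEdge d C → IsZ2Class σ d C →
    ∃ C', (IsHorizontalEdge d' C' ∨ IsThroughClass d' C') ∧ IsZ2Class σ d' C' ∧ C ⊆ C') ∧
  SeparatesThrough d d'

/-- The description of `IsCoarser` by the top rows and the vertices in through classes. -/
structure Refines : Prop where
  le : ∀ {x y}, row d x y → row d' x y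
  mem_through : ∀ {x}, x ∈ through d' ↔ ∃ t ∈ through d, row d' x t
  separates : ∀ {s t}, s ∈ through d → t ∈ through d → row d' s t → row d s t

end Invol

section Stable

variable {X : Type} {σ : X → X} {d d' : Setoid (X ⊕ X)}

lemma IsStable.row_of_row (hs : IsStable σ d) {x y : X} (h : row d x y) : row d (σ x) (σ y) :=
  hs (Sum.inl x) (Sum.inl y) h

lemma IsStable.mem_through (hs : IsStable σ d) {x : X} (h : x ∈ through d) : σ x ∈ through d :=
  hs (Sum.inl x) (Sum.inr x) h

/-- Consequently the type of a component can be tested at a single vertex. -/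
lemma IsStable.rel_invol_iff (hs : IsStable σ d) {p q : X ⊕ X}
    (h : d p q) : d (Sum.map σ σ p) p ↔ d (Sum.map σ σ q) q :=
  ⟨fun h' => d.trans' (d.symm' (hs _ _ h)) (d.trans' h' h),
    fun h' => d.trans' (hs _ _ h) (d.trans' h' (d.symm' h))⟩

lemma IsStable.isEClass_iff (hs : IsStable σ d) {p : X ⊕ X} :
    IsEClass σ d (component d p) ↔ ¬ d (Sum.map σ σ p) p := by
  refine ⟨fun h => h.2 p (d.refl' p), fun h => ⟨component_mem_classes p, fun q hq hq' => h ?_⟩⟩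
  exact (hs.rel_invol_iff hq).1 (d.trans' hq' (d.symm' hq))

lemma IsStable.isZ2Class_iff (hs : IsStable σ d) {p : X ⊕ X} :
    IsZ2Class σ d (component d p) ↔ d (Sum.map σ σ p) p := by
  refine ⟨fun h => h.2 p (d.refl' p), fun h => ⟨component_mem_classes p, fun q hq => ?_⟩⟩
  exact d.trans' ((hs.rel_invol_iff hq).2 h) hq

end Stable

end TwoRow

/-! ### Coarser diagrams in terms of top rows -/

namespace TwoRow

open Z2Setoid

section Count

variable {X : Type} {σ : X → X} {d d' : Setoid (X ⊕ X)} {s₁ s₂ : ℕ}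

lemma ncard_components (P : Set X) : ((fun x => component d (Sum.inl x)) '' P).ncard =
    (Quotient.mk (row d) '' P).ncard :=
  ncard_image_eq_of_forall_eq_iff fun x _ y _ => by
    rw [component_eq_iff, mk_eq_mk]
    exact Iff.rfl

lemma ncard_eThrough (hs : IsStable σ d) (hd : IsDoubled d) :
    {C | IsThroughClass d C ∧ IsEClass σ d C}.ncard =
      (Quotient.mk (row d) '' {x | x ∈ through d ∧ ¬ row d (σ x) x}).ncard := by
  rw [← ncard_components]
  congr 1
  ext C
  constructor
  · rintro ⟨h1, h2⟩
    obtain ⟨x, hx, rfl⟩ := hd.isThroughClass_iff.1 h1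
    exact ⟨x, ⟨hx, hs.isEClass_iff.1 h2⟩, rfl⟩
  · rintro ⟨x, ⟨hx, h⟩, rfl⟩
    exact ⟨hd.isThroughClass_iff.2 ⟨x, hx, rfl⟩, hs.isEClass_iff.2 h⟩

lemma ncard_z2Through (hs : IsStable σ d) (hd : IsDoubled d) :
    {C | IsThroughClass d C ∧ IsZ2Class σ d C}.ncard =
      (Quotient.mk (row d) '' {x | x ∈ through d ∧ row d (σ x) x}).ncard := by
  rw [← ncard_components]
  congr 1
  ext C
  constructor
  · rintro ⟨h1, h2⟩
    obtain ⟨x, hx, rfl⟩ := hd.isThroughClass_iff.1 h1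
    exact ⟨x, ⟨hx, hs.isZ2Class_iff.1 h2⟩, rfl⟩
  · rintro ⟨x, ⟨hx, h⟩, rfl⟩
    exact ⟨hd.isThroughClass_iff.2 ⟨x, hx, rfl⟩, hs.isZ2Class_iff.2 h⟩

lemma numEEdges_eq (hs : IsStable σ d) (hd : IsDoubled d) : numEEdges σ d =
    (Quotient.mk (row d) '' {x | x ∉ through d ∧ ¬ row d (σ x) x}).ncard := by
  rw [← ncard_components, numEEdges]
  congr 1
  ext C
  constructor
  · rintro ⟨h1, h2⟩
    obtain ⟨x, hx, rfl⟩ := hd.isTopEdge_iff.1 h1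
    exact ⟨x, ⟨hx, hs.isEClass_iff.1 h2⟩, rfl⟩
  · rintro ⟨x, ⟨hx, h⟩, rfl⟩
    exact ⟨hd.isTopEdge_iff.2 ⟨x, hx, rfl⟩, hs.isEClass_iff.2 h⟩

lemma numZ2Edges_eq (hs : IsStable σ d) (hd : IsDoubled d) : numZ2Edges σ d =
    (Quotient.mk (row d) '' {x | x ∉ through d ∧ row d (σ x) x}).ncard := by
  rw [← ncard_components, numZ2Edges]
  congr 1
  ext C
  constructor
  · rintro ⟨h1, h2⟩
    obtain ⟨x, hx, rfl⟩ := hd.isTopEdge_iff.1 h1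
    exact ⟨x, ⟨hx, hs.isZ2Class_iff.1 h2⟩, rfl⟩
  · rintro ⟨x, ⟨hx, h⟩, rfl⟩
    exact ⟨hd.isTopEdge_iff.2 ⟨x, hx, rfl⟩, hs.isZ2Class_iff.2 h⟩

lemma IsStable.row_invol_iff (hs : IsStable σ d) {x y : X} (h : row d x y) :
    row d (σ x) x ↔ row d (σ y) y :=
  hs.rel_invol_iff (p := Sum.inl x) (q := Sum.inl y) h

lemma ncard_through [Finite X] (hd : d ∈ J σ s₁ s₂) :
    (Quotient.mk (row d) '' through d).ncard = 2 * s₁ + s₂ := by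
  obtain ⟨hs, hdd, h1, h2⟩ := hd
  rw [← h1, ← h2, ncard_eThrough hs hdd, ncard_z2Through hs hdd,
    ← Set.ncard_union_eq _ (Set.toFinite _) (Set.toFinite _), ← Set.image_union]
  · congr 2
    ext x
    simp only [Set.mem_union, Set.mem_ofPred_eq]
    tauto
  · rw [Set.disjoint_left]
    rintro _ ⟨x, hx, rfl⟩ ⟨y, hy, h⟩
    exact hx.2 ((hs.row_invol_iff ((mk_eq_mk _ _ _).1 h)).1 hy.2)

lemma IsCoarser.exists_through (hs : IsStable σ d) (hd : IsDoubled d) (hd' : IsDoubled d')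
    (h : IsCoarser σ d d') {x : X} (hx : x ∈ through d) : x ∈ through d' ∧
      component d (Sum.inl x) ⊆ component d' (Sum.inl x) := by
  obtain ⟨C', hC', hsub⟩ : ∃ C', IsThroughClass d' C' ∧ component d (Sum.inl x) ⊆ C' := by
    by_cases hr : row d (σ x) x
    · obtain ⟨C', h1, _, h3⟩ := h.2.1 _ (hd.isThroughClass_iff.2 ⟨x, hx, rfl⟩)
        (hs.isZ2Class_iff.2 hr)
      exact ⟨C', h1, h3⟩
    · obtain ⟨C', h1, _, h3⟩ := h.1 _ (hd.isThroughClass_iff.2 ⟨x, hx, rfl⟩)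
        (hs.isEClass_iff.2 hr)
      exact ⟨C', h1, h3⟩
  obtain ⟨y, hy, rfl⟩ := hd'.isThroughClass_iff.1 hC'
  have hxy : row d' x y := hsub (d.refl' _)
  exact ⟨(hd'.mem_through_iff hxy).2 hy, by rwa [component_eq_iff.2 hxy]⟩

lemma IsCoarser.component_subset (hs : IsStable σ d) (hd : IsDoubled d) (hd' : IsDoubled d')
    (h : IsCoarser σ d d') (x : X) :
    component d (Sum.inl x) ⊆ component d' (Sum.inl x) := by
  by_cases hx : x ∈ through d
  · exact (h.exists_through hs hd hd' hx).2
  obtain ⟨C', hC', hsub⟩ : ∃ C' ∈ d'.classes, component d (Sum.inl x) ⊆ C' := by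
    by_cases hr : row d (σ x) x
    · obtain ⟨C', _, h2, h3⟩ := h.2.2.2.1 _ (Or.inl (hd.isTopEdge_iff.2 ⟨x, hx, rfl⟩))
        (hs.isZ2Class_iff.2 hr)
      exact ⟨C', h2.1, h3⟩
    · obtain ⟨C', _, h2, h3⟩ := h.2.2.1 _ (Or.inl (hd.isTopEdge_iff.2 ⟨x, hx, rfl⟩))
        (hs.isEClass_iff.2 hr)
      exact ⟨C', h2.elim And.left And.left, h3⟩
  obtain ⟨p, rfl⟩ := mem_classes_iff.1 hC'
  have hxp : d' (Sum.inl x) p := hsub (d.refl' _)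
  rwa [component_eq_iff.2 hxp]

/-- The numbers of through classes are needed only to exclude new through classes of `d'`. -/
lemma IsCoarser.refines [Finite X] (hd : d ∈ J σ s₁ s₂) (hd' : d' ∈ J σ s₁ s₂)
    (h : IsCoarser σ d d') : Refines d d' := by
  have hle {x y : X} (hxy : row d x y) : row d' x y :=
    h.component_subset hd.1 hd.2.1 hd'.2.1 y hxy
  have hsep {s t : X} (hs : s ∈ through d) (ht : t ∈ through d) (hst : row d' s t) :
      row d s t := by
    have := h.2.2.2.2 _ _ _ (hd.2.1.isThroughClass_iff.2 ⟨s, hs, rfl⟩)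
      (hd.2.1.isThroughClass_iff.2 ⟨t, ht, rfl⟩) (component_mem_classes (d := d') (Sum.inl t))
      (component_eq_iff.2 hst ▸ h.component_subset hd.1 hd.2.1 hd'.2.1 s)
      (h.component_subset hd.1 hd.2.1 hd'.2.1 t)
    exact component_eq_iff.1 this
  refine ⟨hle, fun {x} => ⟨fun hx => ?_, ?_⟩, hsep⟩
  · have hsub : Quotient.mk (row d') '' through d ⊆ Quotient.mk (row d') '' through d' :=
      Set.image_mono fun t ht => (h.exists_through hd.1 hd.2.1 hd'.2.1 ht).1
    have hcard : (Quotient.mk (row d') '' through d).ncard =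
        (Quotient.mk (row d) '' through d).ncard :=
      ncard_image_eq_of_forall_eq_iff fun s hs t ht => by
        rw [mk_eq_mk, mk_eq_mk]
        exact ⟨hsep hs ht, hle⟩
    -- The through classes of `d` inject into those of `d'`, and both number `2 * s₁ + s₂`; hence
    -- each of the latter contains one of the former.
    have heq := Set.eq_of_subset_of_ncard_le hsub
      (by rw [hcard, ncard_through hd, ncard_through hd']) (Set.toFinite _)
    have hx' : Quotient.mk (row d') x ∈ Quotient.mk (row d') '' through d :=
      heq ▸ ⟨x, hx, rfl⟩
    obtain ⟨t, ht, htx⟩ := hx'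
    exact ⟨t, ht, (mk_eq_mk _ _ _).1 htx.symm⟩
  · rintro ⟨t, ht, hxt⟩
    exact (hd'.2.1.mem_through_iff hxt).2 (h.exists_through hd.1 hd.2.1 hd'.2.1 ht).1

lemma Refines.through_subset (h : Refines d d') : through d ⊆ through d' :=
  fun _ hx => h.mem_through.2 ⟨_, hx, (row d').refl' _⟩

lemma Refines.le_of_doubled (hd : IsDoubled d) (hd' : IsDoubled d') (h : Refines d d')
    {p q : X ⊕ X} (hpq : d p q) : d' p q := by
  have aux {x y : X} (hxy : d (Sum.inl x) (Sum.inr y)) : d' (Sum.inl x) (Sum.inr y) := by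
    obtain ⟨h1, h2⟩ := hd.rel_inl_inr.1 hxy
    exact hd'.rel_inl_inr.2 ⟨h.le h1, h.through_subset h2⟩
  rcases p with x | x <;> rcases q with y | y
  · exact h.le hpq
  · exact aux hpq
  · exact d'.symm' (aux (d.symm' hpq))
  · exact hd'.rel_inr_inr.2 (h.le (hd.rel_inr_inr.1 hpq))

lemma Refines.row_invol_iff (hs : IsStable σ d) (h : Refines d d') {t : X}
    (ht : t ∈ through d) : row d' (σ t) t ↔ row d (σ t) t :=
  ⟨h.separates (hs.mem_through ht) ht, h.le⟩

/-- Each through class of `d'` contains exactly one of `d`, of the same type: if `t` and `σ t` are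
related in `d'`, separation relates them in `d`. -/
lemma Refines.mem_J (hd : d ∈ J σ s₁ s₂) (hs' : IsStable σ d') (hd' : IsDoubled d')
    (h : Refines d d') : d' ∈ J σ s₁ s₂ := by
  obtain ⟨hs, hdd, h1, h2⟩ := hd
  refine ⟨hs', hd', ?_, ?_⟩
  · rw [← h1, ncard_eThrough hs hdd, ncard_eThrough hs' hd']
    trans (Quotient.mk (row d') '' {x | x ∈ through d ∧ ¬ row d (σ x) x}).ncard
    · congr 1
      ext c
      constructor
      · rintro ⟨x, ⟨hx, hx'⟩, rfl⟩
        obtain ⟨t, ht, hxt⟩ := h.mem_through.1 hx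
        refine ⟨t, ⟨ht, ?_⟩, (mk_eq_mk _ _ _).2 ((row d').symm' hxt)⟩
        rwa [← h.row_invol_iff hs ht, ← hs'.row_invol_iff hxt]
      · rintro ⟨t, ⟨ht, ht'⟩, rfl⟩
        exact ⟨t, ⟨h.through_subset ht, by rwa [h.row_invol_iff hs ht]⟩, rfl⟩
    · refine ncard_image_eq_of_forall_eq_iff fun s hs t ht => ?_
      rw [mk_eq_mk, mk_eq_mk]
      exact ⟨h.separates hs.1 ht.1, h.le⟩
  · rw [← h2, ncard_z2Through hs hdd, ncard_z2Through hs' hd']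
    trans (Quotient.mk (row d') '' {x | x ∈ through d ∧ row d (σ x) x}).ncard
    · congr 1
      ext c
      constructor
      · rintro ⟨x, ⟨hx, hx'⟩, rfl⟩
        obtain ⟨t, ht, hxt⟩ := h.mem_through.1 hx
        refine ⟨t, ⟨ht, ?_⟩, (mk_eq_mk _ _ _).2 ((row d').symm' hxt)⟩
        rwa [← h.row_invol_iff hs ht, ← hs'.row_invol_iff hxt]
      · rintro ⟨t, ⟨ht, ht'⟩, rfl⟩
        exact ⟨t, ⟨h.through_subset ht, by rwa [h.row_invol_iff hs ht]⟩, rfl⟩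
    · refine ncard_image_eq_of_forall_eq_iff fun s hs t ht => ?_
      rw [mk_eq_mk, mk_eq_mk]
      exact ⟨h.separates hs.1 ht.1, h.le⟩

lemma IsDoubled.isHorizontalEdge_or_isThroughClass (hd : IsDoubled d) (p : X ⊕ X) :
    IsHorizontalEdge d (component d p) ∨ IsThroughClass d (component d p) := by
  rcases p with x | x <;> by_cases hx : x ∈ through d
  · exact Or.inr (hd.isThroughClass_iff.2 ⟨x, hx, rfl⟩)
  · exact Or.inl (Or.inl (hd.isTopEdge_iff.2 ⟨x, hx, rfl⟩))
  · exact Or.inr (hd.isThroughClass_iff.2 ⟨x, hx, component_eq_iff.2 (d.symm' hx)⟩)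
  · exact Or.inl (Or.inr (hd.isBottomEdge_iff.2 ⟨x, hx, rfl⟩))

lemma Refines.isCoarser (hs : IsStable σ d) (hd : IsDoubled d) (hs' : IsStable σ d')
    (hd' : IsDoubled d') (h : Refines d d') : IsCoarser σ d d' := by
  have hsub (p : X ⊕ X) : component d p ⊆ component d' p := fun q hq => h.le_of_doubled hd hd' hq
  have hclass {C : Set (X ⊕ X)} (hC : IsHorizontalEdge d C) : C ∈ d.classes :=
    hC.elim And.left And.left
  refine ⟨?_, ?_, ?_, ?_, ?_⟩
  · intro C hC hE
    obtain ⟨x, hx, rfl⟩ := hd.isThroughClass_iff.1 hC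
    refine ⟨_, hd'.isThroughClass_iff.2 ⟨x, h.through_subset hx, rfl⟩, ?_, hsub _⟩
    rw [hs'.isEClass_iff]
    rw [hs.isEClass_iff] at hE
    exact fun h' => hE ((h.row_invol_iff hs hx).1 h')
  · intro C hC hE
    obtain ⟨x, hx, rfl⟩ := hd.isThroughClass_iff.1 hC
    refine ⟨_, hd'.isThroughClass_iff.2 ⟨x, h.through_subset hx, rfl⟩, ?_, hsub _⟩
    rw [hs'.isZ2Class_iff]
    rw [hs.isZ2Class_iff] at hE
    exact hsub _ hE
  · intro C hC _
    obtain ⟨p, rfl⟩ := mem_classes_iff.1 (hclass hC)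
    refine ⟨_, hd'.isHorizontalEdge_or_isThroughClass p, ?_, hsub _⟩
    rw [hs'.isEClass_iff, hs'.isZ2Class_iff]
    exact (em _).symm
  · intro C hC hE
    obtain ⟨p, rfl⟩ := mem_classes_iff.1 (hclass hC)
    refine ⟨_, hd'.isHorizontalEdge_or_isThroughClass p, ?_, hsub _⟩
    rw [hs'.isZ2Class_iff]
    rw [hs.isZ2Class_iff] at hE
    exact hsub _ hE
  · intro C₁ C₂ C' h1 h2 hC' hs1 hs2
    obtain ⟨x, hx, rfl⟩ := hd.isThroughClass_iff.1 h1
    obtain ⟨y, hy, rfl⟩ := hd.isThroughClass_iff.1 h2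
    obtain ⟨p, rfl⟩ := mem_classes_iff.1 hC'
    exact component_eq_iff.2 (h.separates hx hy
      (d'.trans' (hs1 (d.refl' _)) (d'.symm' (hs2 (d.refl' _)))))

lemma mem_J_and_isCoarser_iff [Finite X] (hd : d ∈ J σ s₁ s₂) :
    d' ∈ J σ s₁ s₂ ∧ IsCoarser σ d d' ↔ IsStable σ d' ∧ IsDoubled d' ∧ Refines d d' :=
  ⟨fun h => ⟨h.1.1, h.1.2.1, h.2.refines hd h.1⟩,
    fun h => ⟨h.2.2.mem_J hd h.1 h.2.1, h.2.2.isCoarser hd.1 hd.2.1 h.1 h.2.1⟩⟩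

/-- A vertex outside the through classes of `d'` is outside those of `d`, so it is related to its
image in `d` and therefore in `d'`. -/
lemma numEEdges_eq_zero [Finite X] (hd : d ∈ J σ s₁ s₂) (h0 : numEEdges σ d = 0)
    (hd' : d' ∈ J σ s₁ s₂) (h : IsCoarser σ d d') : numEEdges σ d' = 0 := by
  have hr := h.refines hd hd'
  rw [numEEdges_eq hd.1 hd.2.1, Set.ncard_eq_zero, Set.image_eq_empty] at h0
  rw [numEEdges_eq hd'.1 hd'.2.1, Set.ncard_eq_zero, Set.image_eq_empty]
  refine Set.eq_empty_of_forall_notMem fun x hx => ?_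
  exact Set.notMem_empty x
    (h0 ▸ ⟨fun h => hx.1 (hr.through_subset h), fun h => hx.2 (hr.le h)⟩)

end Count

end TwoRow

/-! ### Coarser diagrams as relations on the classes of the top row -/

namespace TwoRow

open Z2Setoid

section Quotient

variable {X : Type} {σ : X → X} {d d' : Setoid (X ⊕ X)} {s₁ s₂ : ℕ}

/-- With the empty set nothing is separated; this serves to obtain the involution on the classes. -/
lemma IsStable.isAdmissible_row (hs : IsStable σ d) : IsAdmissible σ ∅ (row d) :=
  ⟨hs.row_of_row, fun h => absurd h (Set.notMem_empty _)⟩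

/-- The involution on the classes of the top row. -/
abbrev rowInvol (hs : IsStable σ d) : Quotient (row d) → Quotient (row d) :=
  classInvol hs.isAdmissible_row

/-- The classes of the top row that belong to through classes. -/
abbrev throughClasses (d : Setoid (X ⊕ X)) : Set (Quotient (row d)) :=
  Quotient.mk (row d) '' through d

lemma IsDoubled.mk_mem_throughClasses (hd : IsDoubled d) {x : X} :
    Quotient.mk (row d) x ∈ throughClasses d ↔ x ∈ through d := by
  constructor
  · rintro ⟨t, ht, h⟩
    exact (hd.mem_through_iff ((mk_eq_mk _ _ _).1 h)).1 ht
  · exact fun h => ⟨x, h, rfl⟩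

lemma rowInvol_mk (hs : IsStable σ d) (x : X) :
    rowInvol hs (Quotient.mk (row d) x) = Quotient.mk (row d) (σ x) := rfl

lemma rowInvol_eq_iff (hs : IsStable σ d) {x : X} :
    rowInvol hs (Quotient.mk (row d) x) = Quotient.mk (row d) x ↔ row d (σ x) x := by
  rw [rowInvol_mk, mk_eq_mk]

lemma setOf_eq_image {A B : Type*} {f : A → B} (hf : Function.Surjective f) {p : B → Prop}
    {q : A → Prop} (h : ∀ a, p (f a) ↔ q a) : {b | p b} = f '' {a | q a} := by
  ext b
  obtain ⟨a, rfl⟩ := hf b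
  constructor
  · exact fun hb => ⟨a, (h a).1 hb, rfl⟩
  · rintro ⟨a', ha', h'⟩
    rw [← h']
    exact (h a').2 ha'

/-- The diagram that belongs to an equivalence relation on the classes of the top row. -/
def diagramOf (d : Setoid (X ⊕ X)) (e : Setoid (Quotient (row d))) : Setoid (X ⊕ X) :=
  double (Setoid.comap (Quotient.mk (row d)) e)
    {x | ∃ t ∈ through d, e (Quotient.mk (row d) x) (Quotient.mk (row d) t)}

variable {e : Setoid (Quotient (row d))}

lemma isDoubled_diagramOf : IsDoubled (diagramOf d e) := by
  apply isDoubled_double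
  intro x y h
  constructor
  · rintro ⟨t, ht, h'⟩
    exact ⟨t, ht, e.trans' (e.symm' h) h'⟩
  · rintro ⟨t, ht, h'⟩
    exact ⟨t, ht, e.trans' h h'⟩

lemma row_diagramOf {x y : X} : row (diagramOf d e) x y ↔
    e (Quotient.mk (row d) x) (Quotient.mk (row d) y) :=
  row_double x y

lemma mem_through_diagramOf {x : X} : x ∈ through (diagramOf d e) ↔
    ∃ t ∈ through d, e (Quotient.mk (row d) x) (Quotient.mk (row d) t) := by
  rw [diagramOf, through_double]
  exact Iff.rfl

lemma diagramOf_injective : Function.Injective (diagramOf d) := by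
  intro e e' h
  ext p q
  induction p using Quotient.inductionOn with
  | h x =>
  induction q using Quotient.inductionOn with
  | h y => rw [← row_diagramOf, h, row_diagramOf]

lemma isStable_diagramOf (hs : IsStable σ d)
    (he : IsAdmissible (rowInvol hs) (throughClasses d) e) : IsStable σ (diagramOf d e) := by
  have hrow {x y : X} (h : row (diagramOf d e) x y) : row (diagramOf d e) (σ x) (σ y) := by
    rw [row_diagramOf] at h ⊢
    exact he.stable h
  have hd : IsDoubled (diagramOf d e) := isDoubled_diagramOf
  have aux {x y : X} (h : diagramOf d e (Sum.inl x) (Sum.inr y)) :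
      diagramOf d e (Sum.inl (σ x)) (Sum.inr (σ y)) := by
    obtain ⟨h1, h2⟩ := hd.rel_inl_inr.1 h
    refine hd.rel_inl_inr.2 ⟨hrow h1, ?_⟩
    obtain ⟨t, ht, h'⟩ := mem_through_diagramOf.1 h2
    exact mem_through_diagramOf.2 ⟨σ t, hs.mem_through ht, he.stable h'⟩
  rintro (x | x) (y | y) h
  · exact hrow h
  · exact aux h
  · exact (diagramOf d e).symm' (aux ((diagramOf d e).symm' h))
  · exact hd.rel_inr_inr.2 (hrow (hd.rel_inr_inr.1 h))

lemma refines_diagramOf (hs : IsStable σ d)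
    (he : IsAdmissible (rowInvol hs) (throughClasses d) e) : Refines d (diagramOf d e) where
  le h := by
    rw [row_diagramOf, (mk_eq_mk _ _ _).2 h]
  mem_through := by
    intro x
    rw [mem_through_diagramOf]
    simp only [row_diagramOf]
  separates h1 h2 h := by
    rw [row_diagramOf] at h
    exact (mk_eq_mk _ _ _).1 (he.separates ⟨_, h1, rfl⟩ ⟨_, h2, rfl⟩ h)

/-- The relation sought is the one that the top row of `d'` induces on the classes of `d`. -/
lemma Refines.exists_diagramOf_eq (hs : IsStable σ d) (hs' : IsStable σ d')
    (hd' : IsDoubled d') (h : Refines d d') :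
    ∃ e, IsAdmissible (rowInvol hs) (throughClasses d) e ∧ diagramOf d e = d' := by
  let e : Setoid (Quotient (row d)) :=
    Setoid.ker (Quotient.lift (Quotient.mk (row d')) fun x y hxy => (mk_eq_mk _ _ _).2 (h.le hxy))
  have he (x y : X) : e (Quotient.mk (row d) x) (Quotient.mk (row d) y) ↔ row d' x y :=
    mk_eq_mk _ _ _
  refine ⟨e, ⟨?_, ?_⟩, ?_⟩
  · intro p q
    induction p using Quotient.inductionOn with
    | h x =>
    induction q using Quotient.inductionOn with
    | h y =>
      rw [rowInvol_mk, rowInvol_mk, he, he]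
      exact hs'.row_of_row
  · rintro _ _ ⟨x, hx, rfl⟩ ⟨y, hy, rfl⟩ hxy
    exact (mk_eq_mk _ _ _).2 (h.separates hx hy ((he x y).1 hxy))
  · apply isDoubled_diagramOf.ext hd'
    · intro x y
      rw [row_diagramOf, he]
    · ext x
      rw [mem_through_diagramOf, h.mem_through]
      simp only [he]

lemma numEEdges_diagramOf (hs : IsStable σ d)
    (he : IsAdmissible (rowInvol hs) (throughClasses d) e) :
    numEEdges σ (diagramOf d e) = numFree (rowInvol hs) (throughClasses d) e := by
  rw [numEEdges_eq (isStable_diagramOf hs he) isDoubled_diagramOf, numFree,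
    setOf_eq_image (f := Quotient.mk (row d)) Quotient.mk_surjective
      (q := fun x => x ∉ through (diagramOf d e) ∧ ¬ row (diagramOf d e) (σ x) x), Set.image_image]
  · refine ncard_image_eq_of_forall_eq_iff fun x _ y _ => ?_
    rw [mk_eq_mk, mk_eq_mk, row_diagramOf]
  · intro x
    rw [mem_through_diagramOf, row_diagramOf, rowInvol_mk, e.comm', and_comm]
    simp

lemma numZ2Edges_diagramOf (hs : IsStable σ d)
    (he : IsAdmissible (rowInvol hs) (throughClasses d) e) :
    numZ2Edges σ (diagramOf d e) = numFixed (rowInvol hs) (throughClasses d) e := by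
  rw [numZ2Edges_eq (isStable_diagramOf hs he) isDoubled_diagramOf, numFixed,
    setOf_eq_image (f := Quotient.mk (row d)) Quotient.mk_surjective
      (q := fun x => x ∉ through (diagramOf d e) ∧ row (diagramOf d e) (σ x) x), Set.image_image]
  · refine ncard_image_eq_of_forall_eq_iff fun x _ y _ => ?_
    rw [mk_eq_mk, mk_eq_mk, row_diagramOf]
  · intro x
    rw [mem_through_diagramOf, row_diagramOf, rowInvol_mk, e.comm', and_comm]
    simp

/-- The number of coarser diagrams with prescribed numbers of horizontal edges. -/
theorem ncard_isCoarser [Finite X] (hσ : Function.Involutive σ) {r₁ r₂ : ℕ}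
    (hd : d ∈ J σ s₁ s₂) (h1 : numEEdges σ d = 2 * r₁) (h2 : numZ2Edges σ d = r₂) (p₁ p₂ : ℕ) :
    {d' | d' ∈ J σ s₁ s₂ ∧ numEEdges σ d' = 2 * p₁ ∧ numZ2Edges σ d' = p₂ ∧
      IsCoarser σ d d'}.ncard = count (2 * s₁ + s₂) s₂ r₁ r₂ p₁ p₂ := by
  have hs := hd.1
  have hdd := hd.2.1
  have himage : {d' | d' ∈ J σ s₁ s₂ ∧ numEEdges σ d' = 2 * p₁ ∧ numZ2Edges σ d' = p₂ ∧
      IsCoarser σ d d'} = diagramOf d '' {e | IsAdmissible (rowInvol hs) (throughClasses d) e ∧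
        numFree (rowInvol hs) (throughClasses d) e = 2 * p₁ ∧
        numFixed (rowInvol hs) (throughClasses d) e = p₂} := by
    ext d'
    constructor
    · rintro ⟨hJ, hE, hZ, hc⟩
      obtain ⟨e, he, rfl⟩ := (hc.refines hd hJ).exists_diagramOf_eq hs hJ.1 hJ.2.1
      exact ⟨e, ⟨he, (numEEdges_diagramOf hs he).symm.trans hE,
        (numZ2Edges_diagramOf hs he).symm.trans hZ⟩, rfl⟩
    · rintro ⟨e, ⟨he, hE, hZ⟩, rfl⟩
      obtain ⟨hJ, hc⟩ := (mem_J_and_isCoarser_iff hd).2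
        ⟨isStable_diagramOf hs he, isDoubled_diagramOf, refines_diagramOf hs he⟩
      exact ⟨hJ, (numEEdges_diagramOf hs he).trans hE, (numZ2Edges_diagramOf hs he).trans hZ, hc⟩
  rw [himage, Set.ncard_image_of_injective _ diagramOf_injective]
  refine ncard_isAdmissible (classInvol_involutive hσ hs.isAdmissible_row) ?_ (ncard_through hd)
    ?_ ?_ ?_ p₁ p₂
  · rintro _ ⟨t, ht, rfl⟩
    exact ⟨σ t, hs.mem_through ht, rfl⟩
  · rw [← hd.2.2.2, ncard_z2Through hs hdd, setOf_eq_image Quotient.mk_surjective]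
    intro x
    rw [hdd.mk_mem_throughClasses, rowInvol_eq_iff hs]
  · rw [← h1, numEEdges_eq hs hdd, setOf_eq_image Quotient.mk_surjective]
    intro x
    rw [hdd.mk_mem_throughClasses, ne_eq, rowInvol_eq_iff hs]
  · rw [← h2, numZ2Edges_eq hs hdd, setOf_eq_image Quotient.mk_surjective]
    intro x
    rw [hdd.mk_mem_throughClasses, rowInvol_eq_iff hs]

/-- If there are no horizontal edges that are not preserved, then the same holds for all coarser
diagrams. -/
theorem ncard_isCoarser_of_numEEdges_eq_zero [Finite X] (hσ : Function.Involutive σ) {r₂ : ℕ}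
    (hd : d ∈ J σ s₁ s₂) (h1 : numEEdges σ d = 0) (h2 : numZ2Edges σ d = r₂) (p₂ : ℕ) :
    {d' | d' ∈ J σ s₁ s₂ ∧ numZ2Edges σ d' = p₂ ∧ IsCoarser σ d d'}.ncard =
      ∑ i ∈ Finset.Icc p₂ r₂, r₂.choose i * s₂ ^ (r₂ - i) * Nat.stirlingSecond i p₂ := by
  -- With `p₁ = 0` the extra condition on free edges holds for every coarser diagram.
  have h := ncard_isCoarser hσ (r₁ := 0) hd h1 h2 0 p₂
  rw [count_eq] at h
  simp only [Finset.Icc_self, Finset.sum_singleton, Nat.sub_self, Nat.choose_self, pow_zero,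
    Nat.stirlingSecond_zero, mul_one, one_mul, Nat.sub_zero, Nat.add_zero] at h
  rw [← h]
  congr 1
  ext d'
  constructor
  · rintro ⟨hJ, hZ, hc⟩
    exact ⟨hJ, numEEdges_eq_zero hd h1 hJ hc, hZ, hc⟩
  · rintro ⟨hJ, _, hZ, hc⟩
    exact ⟨hJ, hZ, hc⟩

end Quotient

end TwoRow

/-! ### The case without through classes -/

namespace Z2Setoid

/-- Since `0 ^ 0 = 1` and other powers of `0` vanish, only `j = r₁ - i` and `l = r₂` contribute. -/
lemma count_zero_zero (r₁ r₂ p₁ p₂ : ℕ) : count 0 0 r₁ r₂ p₁ p₂ =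
    ∑ i ∈ Finset.Icc p₁ r₁, r₁.choose i * 2 ^ (i - p₁) * Nat.stirlingSecond i p₁ *
      Nat.stirlingSecond (r₂ + (r₁ - i)) p₂ := by
  rw [count_eq]
  refine Finset.sum_congr rfl fun i _ => ?_
  congr 1
  rw [Finset.sum_eq_single_of_mem (r₁ - i) (by simp)]
  · simp only [Nat.choose_self, Nat.sub_self, pow_zero, mul_one, one_mul]
    by_cases h : p₂ - (r₁ - i) ≤ r₂
    · rw [Finset.sum_eq_single_of_mem r₂ (by simpa using h)]
      · simp
      · intro l hl hne
        rw [Finset.mem_Icc] at hl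
        rw [zero_pow (by omega), mul_zero, zero_mul]
    -- Here `l = r₂` is out of range, and the Stirling number is zero as well.
    · rw [Finset.Icc_eq_empty h, Finset.sum_empty, Nat.stirlingSecond_eq_zero_of_lt (by omega)]
  · intro j hj hne
    rw [Finset.mem_Icc] at hj
    rw [zero_pow (by omega), mul_zero, zero_mul]

end Z2Setoid

/-! ### Diagrams of `ℤ₂`-relations as the case of `swap` -/

namespace Z2Diagram

/-- The action of the generator of `ℤ₂` on the vertices of a row. -/
def swap {k : ℕ} (p : Row k) : Row k := (p.1, 1 + p.2)

lemma swap_involutive {k : ℕ} : Function.Involutive (swap (k := k)) := by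
  rintro ⟨i, a⟩
  rw [swap, swap, ← add_assoc, show (1 + 1 : ZMod 2) = 0 from rfl, zero_add]

lemma isStable_iff {k : ℕ} (d : Setoid (Row k ⊕ Row k)) :
    IsStable d ↔ TwoRow.IsStable swap d := by
  refine ⟨fun h p q hpq => h 1 p q hpq, fun h g p q hpq => ?_⟩
  have h0 (p : Row k ⊕ Row k) : act 0 p = p := by
    rcases p with p | p <;> simp [act]
  fin_cases g
  · change d (act 0 p) (act 0 q)
    rwa [h0, h0]
  · exact h p q hpq

lemma mem_J_iff {k s₁ s₂ : ℕ} (d : Setoid (Row k ⊕ Row k)) :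
    d ∈ J k s₁ s₂ ↔ d ∈ TwoRow.J swap s₁ s₂ :=
  and_congr (isStable_iff d) Iff.rfl

lemma isCoarser_iff {k : ℕ} (d d' : Setoid (Row k ⊕ Row k)) :
    IsCoarser d d' ↔ TwoRow.IsCoarser swap d d' := Iff.rfl

lemma numEEdges_eq {k : ℕ} (d : Setoid (Row k ⊕ Row k)) :
    numEEdges d = TwoRow.numEEdges swap d := rfl

lemma numZ2Edges_eq {k : ℕ} (d : Setoid (Row k ⊕ Row k)) :
    numZ2Edges d = TwoRow.numZ2Edges swap d := rfl

end Z2Diagram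

/-! ### Partition diagrams as the case of the identity -/

namespace PartitionDiagram

open TwoRow

variable {k s : ℕ} (d d' : Setoid (Fin k ⊕ Fin k))

lemma isStable_id : IsStable id d := by
  intro p q h
  simpa using h

/-- Components are nonempty and the identity preserves them, so all are `ℤ₂`-classes and `s₁ = 0`.
-/
lemma not_isEClass_id (C : Set (Fin k ⊕ Fin k)) : ¬ IsEClass id d C := by
  rintro ⟨hC, h⟩
  obtain ⟨p, rfl⟩ := mem_classes_iff.1 hC
  exact h p (d.refl' p) (by rw [Sum.map_id_id]; exact d.refl' p)

lemma isZ2Class_id_iff (C : Set (Fin k ⊕ Fin k)) : IsZ2Class id d C ↔ C ∈ d.classes := by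
  simp [IsZ2Class]

lemma isThroughClass_and_isZ2Class_iff (C : Set (Fin k ⊕ Fin k)) :
    IsThroughClass d C ∧ IsZ2Class id d C ↔ IsThroughClass d C := by
  rw [isZ2Class_id_iff]
  exact and_iff_left_of_imp And.left

lemma isTopEdge_and_isZ2Class_iff (C : Set (Fin k ⊕ Fin k)) :
    IsTopEdge d C ∧ IsZ2Class id d C ↔ IsTopEdge d C := by
  rw [isZ2Class_id_iff]
  exact and_iff_left_of_imp And.left

lemma isHorizontalEdge_or_isThroughClass_mem {C : Set (Fin k ⊕ Fin k)}
    (h : IsHorizontalEdge d C ∨ IsThroughClass d C) : C ∈ d.classes := by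
  rcases h with (h | h) | h <;> exact h.1

lemma mem_J_iff : d ∈ J k s ↔ d ∈ TwoRow.J id 0 s := by
  simp [J, TwoRow.J, isStable_id, not_isEClass_id, isThroughClass_and_isZ2Class_iff]

lemma numEEdges_id : numEEdges id d = 0 := by
  simp [numEEdges, not_isEClass_id]

lemma numEdges_eq : numEdges d = numZ2Edges id d := by
  simp [numEdges, numZ2Edges, isTopEdge_and_isZ2Class_iff]

lemma isCoarser_iff : IsCoarser d d' ↔ TwoRow.IsCoarser id d d' := by
  constructor
  · rintro ⟨h1, h2, h3⟩
    refine ⟨fun C _ h => absurd h (not_isEClass_id d C), fun C hC _ => ?_,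
      fun C _ h => absurd h (not_isEClass_id d C), fun C hC _ => ?_, h3⟩
    · obtain ⟨C', hC', hsub⟩ := h1 C hC
      exact ⟨C', hC', (isZ2Class_id_iff d' C').2 hC'.1, hsub⟩
    · obtain ⟨C', hC', hsub⟩ := h2 C hC
      exact ⟨C', hC', (isZ2Class_id_iff d' C').2
        (isHorizontalEdge_or_isThroughClass_mem d' hC'), hsub⟩
  · rintro ⟨_, h1, _, h2, h3⟩
    refine ⟨fun C hC => ?_, fun C hC => ?_, h3⟩
    · obtain ⟨C', hC', _, hsub⟩ := h1 C hC ((isZ2Class_id_iff d C).2 hC.1)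
      exact ⟨C', hC', hsub⟩
    · obtain ⟨C', hC', _, hsub⟩ := h2 C hC ((isZ2Class_id_iff d C).2
        (isHorizontalEdge_or_isThroughClass_mem d (Or.inl hC)))
      exact ⟨C', hC', hsub⟩

end PartitionDiagram
theorem lemma3p14 :
    (∀ (k s₁ s₂ r₁ r₂ : ℕ) (d : Setoid (Z2Diagram.Row k ⊕ Z2Diagram.Row k)),
      d ∈ Z2Diagram.J k s₁ s₂ →
      Z2Diagram.numEEdges d = 2 * r₁ → Z2Diagram.numZ2Edges d = r₂ →
      (∀ p₁ p₂ : ℕ,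
        {d' | d' ∈ Z2Diagram.J k s₁ s₂ ∧ Z2Diagram.numEEdges d' = 2 * p₁ ∧
            Z2Diagram.numZ2Edges d' = p₂ ∧ Z2Diagram.IsCoarser d d'}.ncard =
          ∑ i ∈ Finset.Icc p₁ r₁,
            r₁.choose i * 2 ^ (i - p₁) * Nat.stirlingSecond i p₁ *
              ∑ j ∈ Finset.Icc 0 (r₁ - i),
                (r₁ - i).choose j * (2 * s₁ + s₂) ^ (r₁ - i - j) *
                  ∑ l ∈ Finset.Icc (p₂ - j) r₂,
                    r₂.choose l * s₂ ^ (r₂ - l) * Nat.stirlingSecond (l + j) p₂) ∧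
      (r₁ = 0 → ∀ p₂ : ℕ,
        {d' | d' ∈ Z2Diagram.J k s₁ s₂ ∧ Z2Diagram.numZ2Edges d' = p₂ ∧
            Z2Diagram.IsCoarser d d'}.ncard =
          ∑ i ∈ Finset.Icc p₂ r₂, r₂.choose i * s₂ ^ (r₂ - i) * Nat.stirlingSecond i p₂) ∧
      (s₁ = 0 → s₂ = 0 → ∀ p₁ p₂ : ℕ,
        {d' | d' ∈ Z2Diagram.J k s₁ s₂ ∧ Z2Diagram.numEEdges d' = 2 * p₁ ∧
            Z2Diagram.numZ2Edges d' = p₂ ∧ Z2Diagram.IsCoarser d d'}.ncard =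
          ∑ i ∈ Finset.Icc p₁ r₁,
            r₁.choose i * 2 ^ (i - p₁) * Nat.stirlingSecond i p₁ *
              Nat.stirlingSecond (r₂ + (r₁ - i)) p₂)) ∧
    (∀ (k s r : ℕ) (d : Setoid (Fin k ⊕ Fin k)),
      d ∈ PartitionDiagram.J k s → PartitionDiagram.numEdges d = r →
      ∀ p : ℕ,
        {d' | d' ∈ PartitionDiagram.J k s ∧ PartitionDiagram.numEdges d' = p ∧
            PartitionDiagram.IsCoarser d d'}.ncard =
          ∑ i ∈ Finset.Icc p r, r.choose i * s ^ (r - i) * Nat.stirlingSecond i p) := by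

  refine ⟨fun k s₁ s₂ r₁ r₂ d hd h1 h2 => ?_, fun k s r d hd hr p => ?_⟩
  · rw [Z2Diagram.mem_J_iff] at hd
    simp only [Z2Diagram.mem_J_iff, Z2Diagram.isCoarser_iff, Z2Diagram.numEEdges_eq,
      Z2Diagram.numZ2Edges_eq] at h1 h2 ⊢
    have key := TwoRow.ncard_isCoarser Z2Diagram.swap_involutive hd h1 h2
    refine ⟨fun p₁ p₂ => (key p₁ p₂).trans (Z2Setoid.count_eq _ _ _ _ _ _), ?_, ?_⟩
    · rintro rfl p₂
      exact TwoRow.ncard_isCoarser_of_numEEdges_eq_zero Z2Diagram.swap_involutive hd h1 h2 p₂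
    · rintro rfl rfl p₁ p₂
      exact (key p₁ p₂).trans (Z2Setoid.count_zero_zero _ _ _ _)
  · rw [PartitionDiagram.mem_J_iff] at hd
    rw [PartitionDiagram.numEdges_eq] at hr
    simp only [PartitionDiagram.mem_J_iff, PartitionDiagram.isCoarser_iff,
      PartitionDiagram.numEdges_eq]
    exact TwoRow.ncard_isCoarser_of_numEEdges_eq_zero (fun _ => rfl) hd
      (PartitionDiagram.numEEdges_id d) hr p
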